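/- Let $m\ge 1$ and $l\ge 0$ be integers. Let $h=(h_1,\dots,h_l)\colon\mathbb{R}^{m+l}\to\mathbb{R}^l$ be a smooth ($C^\infty$) map such that $\operatorname{rank} dh(x)=l$ for every $x\in h^{-1}(0)$, so that $h^{-1}(0)$ is a smooth submanifold of $\mathbb{R}^{m+l}$ of dimension $m$ (if non-empty), and let $f=(f_1,\dots,f_{2m-1})\colon\mathbb{R}^{m+l}\to\mathbb{R}^{2m-1}$ be smooth. Regard the Jacobian matrix $d(h,f)$ of $(h,f)=(h_1,\dots,h_l,f_1,\dots,f_{2m-1})$ as a map from $\mathbb{R}^{m+l}$ to the space $M_{m+l}(\mathbb{R}^{2m-1+l})$ of real $(2m-1+l)\times(m+l)$ matrices, and let $\Sigma^1\subset M_{m+l}(\mathbb{R}^{2m-1+l})$ be the submanifold of matrices of corank $1$, i.e. of rank $m+l-1$. For an $m$-dimensional manifold $M$, a point $p\in M$ is called a cross-cap of a smooth map $g\colon M\to\mathbb{R}^{2m-1}$ if there are smooth coordinate systems on $M$ centred at $p$ and on $\mathbb{R}^{2m-1}$ centred at $g(p)$ in which, near $p$, the map $g$ has the form $$(x_1,\dots,x_m)\mapsto(x_1^2,\,x_2,\dots,x_m,\,x_1x_2,\dots,x_1x_m).$$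 A smooth map $a\colon M\to W$ is transversal to a submanifold $N\subset W$ at $p$ if either $a(p)\notin N$ or $da(p)(T_pM)+T_{a(p)}N=T_{a(p)}W$. Then a point $p\in h^{-1}(0)$ is a cross-cap of the restriction $f|h^{-1}(0)$ if and only if $$\operatorname{rank} d(h,f)(p)=m+l-1\quad\text{and}\quad d(h,f)|h^{-1}(0)\ \text{is transversal to}\ \Sigma^1\ \text{at}\ p.$$ -/

import Mathlib

open Set Filter Topology
open scoped ContDiff Matrix

attribute [local instance] Matrix.normedAddCommGroup Matrix.normedSpace

/-- The tangent space at `x` of an embedded smooth submanifold `S` of a normed space `E`, as a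
linear subspace of `E`: the span of the velocities at time `0` of the curves in `S` through `x`
that are smooth near `0`. (For a submanifold these velocities already form a subspace.) -/
def submanifoldTangentSpace {E : Type*} [NormedAddCommGroup E] [NormedSpace ℝ E]
    (S : Set E) (x : E) : Submodule ℝ E :=
  Submodule.span ℝ {v : E | ∃ γ : ℝ → E, ContDiffAt ℝ ∞ γ 0 ∧ γ 0 = x ∧
    (∀ᶠ t in 𝓝 (0 : ℝ), γ t ∈ S) ∧ HasDerivAt γ v 0}

/-- Transversality at `p ∈ M` of the restriction `a|M` to the submanifold `N` of `W`, where `M` is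
an embedded submanifold of `E` and `a` is a smooth map on `E`; the differential at `p` of `a|M` is
the restriction of the differential of `a` to the tangent space of `M`:
either `a p ∉ N`, or `d(a|M)(p) (T_p M) + T_{a(p)} N = W`. -/
def RestrictTransversalAt {E W : Type*} [NormedAddCommGroup E] [NormedSpace ℝ E]
    [NormedAddCommGroup W] [NormedSpace ℝ W] (a : E → W) (M : Set E) (N : Set W) (p : E) : Prop :=
  a p ∈ N →
    (submanifoldTangentSpace M p).map (fderiv ℝ a p).toLinearMap ⊔
      submanifoldTangentSpace N (a p) = ⊤

/-- The Jacobian matrix of `g : ℝ^κ → ℝ^ι` at `x`: entry `(i, j)` is `∂g_i/∂x_j (x)`. -/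
noncomputable def jacobianMatrix {ι κ : Type*} [Fintype ι] [Fintype κ] [DecidableEq κ]
    (g : EuclideanSpace ℝ κ → EuclideanSpace ℝ ι) (x : EuclideanSpace ℝ κ) : Matrix ι κ ℝ :=
  Matrix.of fun i j => fderiv ℝ g x (EuclideanSpace.single j 1) i

/-- The map `(h, f)` with components `h_1, …, h_l, f_1, …, f_r`. -/
def mapPair {E ι ι' : Type*} (h : E → EuclideanSpace ℝ ι) (f : E → EuclideanSpace ℝ ι') :
    E → EuclideanSpace ℝ (ι ⊕ ι') :=
  fun x => WithLp.toLp 2 (Sum.elim (h x) (f x))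

/-- `Σ^c`: the set of real matrices (with at least as many rows as columns) of corank `c`,
i.e. whose rank is the number of columns minus `c`. -/
def corankSet (ι κ : Type*) [Fintype κ] (c : ℕ) : Set (Matrix ι κ ℝ) :=
  {A | A.rank + c = Fintype.card κ}

/-- `φ` is a smooth local coordinate system on the `m`-dimensional embedded submanifold `M` of `E`:
a homeomorphism from an open subset of `M` onto an open subset of `ℝ^m`, whose inverse is, as
a map into `E`, a smooth immersion. -/
def IsSubmanifoldChart {E : Type*} [NormedAddCommGroup E] [NormedSpace ℝ E] {M : Set E} {m : ℕ}
    (φ : OpenPartialHomeomorph M (EuclideanSpace ℝ (Fin m))) : Prop :=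
  ContDiffOn ℝ ∞ (fun x => (φ.symm x : E)) φ.target ∧
    ∀ x ∈ φ.target, Function.Injective (fderiv ℝ (fun x => (φ.symm x : E)) x)

/-- `ψ` is a smooth local coordinate system on the open set `ψ.source ⊆ F`: a diffeomorphism
between open sets. -/
def IsSmoothCoordinates {F F' : Type*} [NormedAddCommGroup F] [NormedSpace ℝ F]
    [NormedAddCommGroup F'] [NormedSpace ℝ F'] (ψ : OpenPartialHomeomorph F F') : Prop :=
  ContDiffOn ℝ ∞ ψ ψ.source ∧ ContDiffOn ℝ ∞ ψ.symm ψ.target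

/-- `(x_1, …, x_m) ↦ (x_1², x_2, …, x_m, x_1 x_2, …, x_1 x_m)` (indices start at `0` below). -/
noncomputable def crossCapNormalForm (m : ℕ) (x : EuclideanSpace ℝ (Fin m)) :
    EuclideanSpace ℝ (Fin (2 * m - 1)) :=
  WithLp.toLp 2 fun i : Fin (2 * m - 1) =>
    if (i : ℕ) = 0 then x ⟨0, by have := i.isLt; omega⟩ ^ 2
    else if hi : (i : ℕ) < m then x ⟨i, hi⟩
    else x ⟨0, by have := i.isLt; omega⟩ * x ⟨(i : ℕ) - m + 1, by have := i.isLt; omega⟩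

/-- `p` is a cross-cap of `f : M → ℝ^{2m-1}`, with `M` an `m`-dimensional embedded submanifold: in
suitable smooth coordinate systems on `M` centred at `p` and on `ℝ^{2m-1}` centred at `f p`, the map
`f` coincides near `p` with the normal form. -/
def IsCrossCap {E : Type*} [NormedAddCommGroup E] [NormedSpace ℝ E] {M : Set E} {m : ℕ}
    (f : M → EuclideanSpace ℝ (Fin (2 * m - 1))) (p : M) : Prop :=
  ∃ (φ : OpenPartialHomeomorph M (EuclideanSpace ℝ (Fin m)))
    (ψ : OpenPartialHomeomorph (EuclideanSpace ℝ (Fin (2 * m - 1)))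
      (EuclideanSpace ℝ (Fin (2 * m - 1)))),
    IsSubmanifoldChart φ ∧ p ∈ φ.source ∧ φ p = 0 ∧
    IsSmoothCoordinates ψ ∧ f p ∈ ψ.source ∧ ψ (f p) = 0 ∧
    ∀ᶠ x in 𝓝 (0 : EuclideanSpace ℝ (Fin m)),
      f (φ.symm x) ∈ ψ.source ∧ ψ (f (φ.symm x)) = crossCapNormalForm m x

/-!
# Cross-caps of maps on regular level sets

Let `m = k + 1`. The proof goes through a condition on the 2-jet of a map `g` from a space of
dimension `m` to one of dimension `2m - 1`, `IsWhitneyPoint`: the kernel of `dg` is spanned by a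
vector `κ ≠ 0`, and every vector of the target is of the form `d²g (v, κ) + dg (u)`.

* This condition does not depend on the coordinates in source and target
  (`IsWhitneyPoint.of_germEquiv`, by the chain rule for second derivatives), and the cross-cap
  `(x, y) ↦ (y, x², x • y)` satisfies it. Hence a cross-cap of `f|h⁻¹(0)` is a Whitney point of `f`
  read in any chart of `h⁻¹(0)`.

* Conversely, a Whitney point is a cross-cap (`IsWhitneyPoint.germEquiv`). As `dg` has rank `k`, the
  map is `(x, y) ↦ (y, c (x, y), d (x, y))` in suitable coordinates, where the restriction of `c`
  to the line `y = 0` has a nondegenerate critical point at `0`. By the Morse lemma with parameters,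
  `c` becomes `x²` up to a function of `y`. By Whitney's theorem on even functions with parameters,
  `d (x, y) = a (x², y) + x • b (x², y)` near `0` with `a` and `b` smooth, and `a` is removed by a
  change of coordinates in the target. The condition on the 2-jet says that `y ↦ b (0, y)` is a
  local diffeomorphism, so `(s, y) ↦ (s, b (s, y))` gives coordinates in which the map is the
  cross-cap.

* Whitney's theorem (`exists_contDiff_even_add_odd_smul`) is obtained from the Fourier
  inversion formula. The even part in `x` of a Schwartz function is an integral of
  `cos (2π ξ x)` times an exponential in `y`; since `cos u = C (u²)` with `C` smooth, and bounded
  with all its derivatives on `[0, ∞)`, replacing `cos (2π ξ x)` by `C (4π² ξ² s)` gives a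
  function that is smooth in `(s, y)`. Odd functions are reduced to even ones by Hadamard's lemma.

* The two conditions on `d(h, f)` are translated into a condition on 2-jets as well. The tangent
  space of `h⁻¹(0)` at `p` is the kernel of `dh(p)`, and the tangent space of the matrices of
  corank 1 at `A`, with kernel spanned by `κ`, is `{B | B κ ∈ im A}`
  (`mem_submanifoldTangentSpace_corankSet_iff`). So rank and transversality say that
  `ker d(h, f)(p)` is spanned by some `κ ≠ 0`, and that every vector is of the form
  `d²(h, f) (v, κ) + d(h, f) (u)` with `v ∈ ker dh(p)`. Differentiating `h ∘ θ = 0` twice for a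
  parametrization `θ` of `h⁻¹(0)` identifies this with `IsWhitneyPoint (f ∘ θ)`
  (`isWhitneyPoint_comp_iff`).
-/

/-! ### Parametric integrals and Hadamard's lemma -/

open MeasureTheory in
/-- A parametric integral of a jointly smooth integrand is smooth, provided all derivatives in the
parameter are locally uniformly dominated by integrable functions. (Differentiating replaces the
target `F` by `E →L[ℝ] F`, and the induction needs both in the same universe.) -/
theorem contDiff_integral_of_dominated {E F : Type u} {V : Type v}
    [NormedAddCommGroup E] [NormedSpace ℝ E] [NormedAddCommGroup F] [NormedSpace ℝ F]
    [NormedAddCommGroup V] [NormedSpace ℝ V] [MeasurableSpace V] [OpensMeasurableSpace V]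
    [SecondCountableTopology V] {μ : Measure V} {K : E → V → F}
    (hK : ContDiff ℝ ∞ (Function.uncurry K))
    (hb : ∀ (n : ℕ) (u₀ : E), ∃ ε > 0, ∃ b : V → ℝ, Integrable b μ ∧
      ∀ᵐ z ∂μ, ∀ u ∈ Metric.ball u₀ ε, ‖iteratedFDeriv ℝ n (fun u => K u z) u‖ ≤ b z) :
    ContDiff ℝ ∞ fun u => ∫ z, K u z ∂μ := by
  suffices H : ∀ (k : ℕ) (F : Type u) [NormedAddCommGroup F] [NormedSpace ℝ F] (K : E → V → F)
      (_ : ContDiff ℝ ∞ (Function.uncurry K))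
      (_ : ∀ (n : ℕ) (u₀ : E), ∃ ε > 0, ∃ b : V → ℝ, Integrable b μ ∧
        ∀ᵐ z ∂μ, ∀ u ∈ Metric.ball u₀ ε, ‖iteratedFDeriv ℝ n (fun u => K u z) u‖ ≤ b z),
      ContDiff ℝ k fun u => ∫ z, K u z ∂μ from
    contDiff_infty.2 fun k => H k F K hK hb
  clear hK hb K
  intro k
  induction k with
  | zero =>
    intro F _ _ K hK hb
    rw [Nat.cast_zero, contDiff_zero, continuous_iff_continuousAt]
    intro u₀
    obtain ⟨ε, hε, b, hbi, hb⟩ := hb 0 u₀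
    refine continuousAt_of_dominated (bound := b) ?_ ?_ hbi ?_
    · exact Eventually.of_forall fun u =>
        (hK.continuous.comp (Continuous.prodMk_right u)).aestronglyMeasurable
    · filter_upwards [Metric.ball_mem_nhds u₀ hε] with u hu
      filter_upwards [hb] with z hz
      simpa using hz u hu
    · exact Eventually.of_forall fun z =>
        (hK.continuous.comp (Continuous.prodMk_left z)).continuousAt
  | succ k ih =>
    intro F _ _ K hK hb
    push_cast
    rw [contDiff_succ_iff_hasFDerivAt]
    have hKz : ∀ z, ContDiff ℝ ∞ fun u => K u z := fun z =>
      hK.comp (contDiff_id.prodMk contDiff_const)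
    have hDK : ContDiff ℝ ∞ (Function.uncurry fun u z => fderiv ℝ (fun u => K u z) u) := by
      refine ContDiff.fderiv (f := fun (p : E × V) u => K u p.2) (m := ∞) ?_ contDiff_fst (by simp)
      exact hK.comp (contDiff_snd.prodMk (contDiff_snd.comp contDiff_fst))
    refine ⟨fun u => ∫ z, fderiv ℝ (fun u => K u z) u ∂μ, ih _ _ hDK ?_, ?_⟩
    · intro n u₀
      obtain ⟨ε, hε, b, hbi, hb⟩ := hb (n + 1) u₀
      refine ⟨ε, hε, b, hbi, ?_⟩
      filter_upwards [hb] with z hz u hu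
      exact norm_iteratedFDeriv_fderiv.trans_le (hz u hu)
    · intro u₀
      obtain ⟨ε, hε, b, hbi, hb1⟩ := hb 1 u₀
      obtain ⟨ε', hε', b', hbi', hb0⟩ := hb 0 u₀
      have hm : ∀ u, AEStronglyMeasurable (K u) μ := fun u =>
        (hK.continuous.comp (Continuous.prodMk_right u)).aestronglyMeasurable
      refine hasFDerivAt_integral_of_dominated_of_fderiv_le (bound := b)
        (F' := fun u z => fderiv ℝ (fun u => K u z) u)
        (Metric.ball_mem_nhds u₀ hε) (Eventually.of_forall hm) ?_ ?_ ?_ hbi ?_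
      · refine hbi'.mono' (hm _) ?_
        filter_upwards [hb0] with z hz
        simpa using hz u₀ (Metric.mem_ball_self hε')
      · exact (hDK.continuous.comp (Continuous.prodMk_right u₀)).aestronglyMeasurable
      · filter_upwards [hb1] with z hz u hu
        have := hz u hu
        rwa [← zero_add 1, ← norm_iteratedFDeriv_fderiv, norm_iteratedFDeriv_zero] at this
      · exact Eventually.of_forall fun z u _ =>
          ((hKz z).differentiable (by simp) _).hasFDerivAt

open MeasureTheory in
/-- A parametric integral of a jointly smooth integrand over `[0, 1]` is smooth. -/
theorem contDiff_integral_Icc {E F : Type u}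
    [NormedAddCommGroup E] [NormedSpace ℝ E] [FiniteDimensional ℝ E]
    [NormedAddCommGroup F] [NormedSpace ℝ F] {K : E → ℝ → F}
    (hK : ContDiff ℝ ∞ (Function.uncurry K)) :
    ContDiff ℝ ∞ fun u => ∫ t in Icc (0 : ℝ) 1, K u t := by
  refine contDiff_integral_of_dominated hK fun n u₀ => ?_
  have : ProperSpace E := FiniteDimensional.proper ℝ E
  have hc : Continuous fun p => iteratedFDeriv ℝ n (Function.uncurry K) p :=
    hK.continuous_iteratedFDeriv (by exact_mod_cast le_top)
  obtain ⟨C, hC⟩ := ((isCompact_closedBall u₀ 1).prod (isCompact_Icc (a := (0 : ℝ)) (b := 1))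
    ).exists_bound_of_continuousOn hc.continuousOn
  refine ⟨1, one_pos, fun _ => C, integrable_const C, ?_⟩
  filter_upwards [ae_restrict_mem measurableSet_Icc] with t ht u hu
  have h1 : (fun u => K u t) = (fun p => Function.uncurry K ((0, t) + p)) ∘
      (ContinuousLinearMap.inl ℝ E ℝ) := by
    ext u; simp
  have h4 : ContDiff ℝ ∞ fun p => Function.uncurry K ((0, t) + p) :=
    hK.comp (contDiff_const.add contDiff_id)
  rw [h1, ContinuousLinearMap.iteratedFDeriv_comp_right (n := ∞) _ h4 _ (by exact_mod_cast le_top)]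
  refine (ContinuousMultilinearMap.norm_compContinuousLinearMap_le _ _).trans ?_
  rw [iteratedFDeriv_comp_add_left]
  have h2 : ‖ContinuousLinearMap.inl ℝ E ℝ‖ ≤ 1 :=
    ContinuousLinearMap.norm_inl_le_one ℝ E ℝ
  have h3 := hC (u, t) ⟨Metric.ball_subset_closedBall hu, ht⟩
  calc _ ≤ ‖iteratedFDeriv ℝ n (Function.uncurry K) (u, t)‖ * 1 := by
        simp only [Finset.prod_const]
        gcongr
        · simp
        · exact pow_le_one₀ (norm_nonneg _) h2
    _ ≤ C := by simpa using h3

open MeasureTheory in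
/-- Hadamard's lemma in the first variable. -/
theorem exists_contDiff_eq_add_smul {Y Z : Type u} [NormedAddCommGroup Y] [NormedSpace ℝ Y]
    [FiniteDimensional ℝ Y] [NormedAddCommGroup Z] [NormedSpace ℝ Z] [CompleteSpace Z]
    {F : ℝ × Y → Z} (hF : ContDiff ℝ ∞ F) :
    ∃ F₁ : ℝ × Y → Z, ContDiff ℝ ∞ F₁ ∧ ∀ u, F u = F (0, u.2) + u.1 • F₁ u := by
  refine ⟨fun u => ∫ t in Icc (0 : ℝ) 1, fderiv ℝ F (t * u.1, u.2) (1, 0),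
    contDiff_integral_Icc ?_, fun u => ?_⟩
  · have h1 : ContDiff ℝ ∞ (fderiv ℝ F) := hF.fderiv_right (by simp)
    simp only [Function.uncurry_def]
    fun_prop
  · have hd : ∀ t : ℝ, HasDerivAt (fun t : ℝ => F (t * u.1, u.2))
        (u.1 • fderiv ℝ F (t * u.1, u.2) (1, 0)) t := fun t => by
      have h1 : HasDerivAt (fun t : ℝ => (t * u.1, u.2)) (u.1, 0) t := by
        simpa using ((hasDerivAt_id t).mul_const u.1).prodMk (hasDerivAt_const t u.2)
      have h2 := ((hF.differentiable (by simp)).differentiableAt (x := (t * u.1, u.2))).hasFDerivAt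
      have h3 := h2.comp_hasDerivAt t h1
      rw [← map_smul, show u.1 • ((1, 0) : ℝ × Y) = (u.1, 0) by simp]
      exact h3
    have hc : Continuous fun t : ℝ => u.1 • fderiv ℝ F (t * u.1, u.2) (1, 0) := by
      have h1 : Continuous (fderiv ℝ F) := hF.continuous_fderiv (by simp)
      fun_prop
    have := intervalIntegral.integral_eq_sub_of_hasDerivAt (fun t _ => hd t)
      (hc.intervalIntegrable 0 1)
    simp only
    rw [integral_Icc_eq_integral_Ioc, ← integral_smul, ← intervalIntegral.integral_of_le zero_le_one,
      this]
    simp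

/-! ### The function `cos √t` -/

/-- The entire function `∑ (-1)ᵏ tᵏ / (2k)!`, which satisfies `cosSqrt (x ^ 2) = cos x`. -/
noncomputable def cosSqrt : ℝ → ℝ :=
  FormalMultilinearSeries.ofScalarsSum fun k => (-1 : ℝ) ^ k / (2 * k).factorial

theorem contDiff_cosSqrt : ContDiff ℝ ∞ cosSqrt := by
  have hr : (FormalMultilinearSeries.ofScalars ℝ
      fun k => (-1 : ℝ) ^ k / (2 * k).factorial).radius = ⊤ := by
    apply FormalMultilinearSeries.ofScalars_radius_eq_top_of_tendsto
    · exact Eventually.of_forall fun n => by positivity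
    · have h1 : ∀ n : ℕ, ‖(-1 : ℝ) ^ n.succ / (2 * n.succ).factorial‖ /
          ‖(-1 : ℝ) ^ n / (2 * n).factorial‖ = 1 / (2 * n + 1) * (1 / (2 * n + 2)) := fun n => by
        have h2 : (2 * n.succ).factorial = (2 * n + 2) * ((2 * n + 1) * (2 * n).factorial) := by
          rw [show 2 * n.succ = 2 * n + 1 + 1 by omega, Nat.factorial_succ, Nat.factorial_succ]
        have h3 : ((2 * n).factorial : ℝ) ≠ 0 := by positivity
        rw [h2]
        simp only [norm_div, norm_pow, norm_neg, norm_one, one_pow, RCLike.norm_natCast]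
        push_cast
        field_simp
      simp_rw [h1]
      have h4 : Tendsto (fun n : ℕ => (2 * n : ℝ)) atTop atTop :=
        tendsto_natCast_atTop_atTop.const_mul_atTop two_pos
      simpa using (tendsto_const_nhds (x := (1 : ℝ)).div_atTop (tendsto_atTop_add_const_right _ 1 h4)).mul
        (tendsto_const_nhds (x := (1 : ℝ)).div_atTop (tendsto_atTop_add_const_right _ 2 h4))
  have := FormalMultilinearSeries.hasFPowerSeriesOnBall _ (hr ▸ ENNReal.zero_lt_top)
  rw [hr] at this
  exact contDiff_iff_contDiffAt.2 fun x =>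
    (this.analyticAt_of_mem (by simp)).contDiffAt

theorem cosSqrt_sq (x : ℝ) : cosSqrt (x ^ 2) = Real.cos x := by
  rw [← (Real.hasSum_cos x).tsum_eq, cosSqrt, FormalMultilinearSeries.ofScalars_sum_eq]
  refine tsum_congr fun n => ?_
  rw [smul_eq_mul, ← pow_mul]
  ring

/-- The equation `4 t C'' + 2 C' + C = 0` for `C = cosSqrt`, differentiated `n` times. -/
theorem iteratedDeriv_cosSqrt_ode (n : ℕ) {t : ℝ} (ht : 0 < t) :
    4 * t * iteratedDeriv (n + 2) cosSqrt t + (4 * n + 2) * iteratedDeriv (n + 1) cosSqrt t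
      + iteratedDeriv n cosSqrt t = 0 := by
  have hd : ∀ (n : ℕ) (t : ℝ), HasDerivAt (iteratedDeriv n cosSqrt)
      (iteratedDeriv (n + 1) cosSqrt t) t := fun n t => by
    rw [iteratedDeriv_succ]
    exact (contDiff_cosSqrt.differentiable_iteratedDeriv n (by exact_mod_cast WithTop.coe_lt_top _) t
      ).hasDerivAt
  induction n generalizing t with
  | zero =>
    have h1 : ∀ x : ℝ, 2 * x * iteratedDeriv 1 cosSqrt (x ^ 2) = - Real.sin x := fun x => by
      have h2 := (hd 0 (x ^ 2)).comp x (hasDerivAt_pow 2 x)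
      have h3 : (iteratedDeriv 0 cosSqrt ∘ fun x : ℝ => x ^ 2) = Real.cos := by
        ext x; simp [cosSqrt_sq]
      rw [h3] at h2
      have := h2.unique (Real.hasDerivAt_cos x)
      rw [← this]; simp; ring
    have h2 : ∀ x : ℝ, 2 * iteratedDeriv 1 cosSqrt (x ^ 2) +
        2 * x * (2 * x * iteratedDeriv 2 cosSqrt (x ^ 2)) = - Real.cos x := fun x => by
      have h3 := ((hasDerivAt_id x).const_mul 2).mul ((hd 1 (x ^ 2)).comp x (hasDerivAt_pow 2 x))
      have h4 : (fun x : ℝ => 2 * x * iteratedDeriv 1 cosSqrt (x ^ 2)) = fun x => - Real.sin x :=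
        funext h1
      have h5 := (h3.congr_of_eventuallyEq (f₁ := fun x => - Real.sin x)
        (Eventually.of_forall fun x => by simp [← h1])).unique (Real.hasDerivAt_sin x).neg
      rw [← h5]
      simp only [Function.comp_apply, id]
      push_cast
      ring
    have h3 := h2 (√t)
    rw [← cosSqrt_sq, Real.sq_sqrt ht.le] at h3
    have h4 := Real.mul_self_sqrt ht.le
    simp only [iteratedDeriv_zero, Nat.cast_zero, zero_add]
    linear_combination h3 - 4 * iteratedDeriv 2 cosSqrt t * h4
  | succ n ih =>
    have h1 := ((((hasDerivAt_id t).const_mul 4).mul (hd (n + 2) t)).add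
      ((hd (n + 1) t).const_mul (4 * n + 2 : ℝ))).add (hd n t)
    have h2 := (h1.congr_of_eventuallyEq (f₁ := fun _ => 0) (by
      filter_upwards [lt_mem_nhds ht] with s hs using (ih hs).symm)).unique (hasDerivAt_const t 0)
    push_cast
    simp at h2
    linear_combination h2

/-- All derivatives of `cosSqrt` are bounded on `[0, ∞)`: by the differential equation, the energy
`Cₙ² + 4 t Cₙ₊₁²` of the `n`-th derivative `Cₙ` decreases. -/
theorem abs_iteratedDeriv_cosSqrt_le (n : ℕ) {t : ℝ} (ht : 0 ≤ t) :
    |iteratedDeriv n cosSqrt t| ≤ |iteratedDeriv n cosSqrt 0| := by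
  have hd : ∀ (n : ℕ) (t : ℝ), HasDerivAt (iteratedDeriv n cosSqrt)
      (iteratedDeriv (n + 1) cosSqrt t) t := fun n t => by
    rw [iteratedDeriv_succ]
    exact (contDiff_cosSqrt.differentiable_iteratedDeriv n (by exact_mod_cast WithTop.coe_lt_top _) t
      ).hasDerivAt
  have hE : ∀ t : ℝ, HasDerivAt
      (fun t => iteratedDeriv n cosSqrt t ^ 2 + 4 * t * iteratedDeriv (n + 1) cosSqrt t ^ 2)
      (2 * iteratedDeriv n cosSqrt t * iteratedDeriv (n + 1) cosSqrt t +
        (4 * iteratedDeriv (n + 1) cosSqrt t ^ 2 + 4 * t *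
          (2 * iteratedDeriv (n + 1) cosSqrt t * iteratedDeriv (n + 2) cosSqrt t))) t := fun t => by
    refine HasDerivAt.congr_deriv (f' := _)
      (((hd n t).pow 2).add (((hasDerivAt_id t).const_mul 4).mul ((hd (n + 1) t).pow 2))) ?_
    simp
  have hanti : AntitoneOn
      (fun t => iteratedDeriv n cosSqrt t ^ 2 + 4 * t * iteratedDeriv (n + 1) cosSqrt t ^ 2)
      (Ici 0) := by
    refine antitoneOn_of_deriv_nonpos (convex_Ici 0)
      (fun t _ => (hE t).continuousAt.continuousWithinAt)
      (fun t _ => (hE t).differentiableAt.differentiableWithinAt) fun t ht => ?_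
    rw [interior_Ici] at ht
    rw [(hE t).deriv]
    have := iteratedDeriv_cosSqrt_ode n ht
    have h1 : 2 * iteratedDeriv n cosSqrt t * iteratedDeriv (n + 1) cosSqrt t +
        (4 * iteratedDeriv (n + 1) cosSqrt t ^ 2 + 4 * t *
          (2 * iteratedDeriv (n + 1) cosSqrt t * iteratedDeriv (n + 2) cosSqrt t)) =
        - (8 * n * iteratedDeriv (n + 1) cosSqrt t ^ 2) := by
      linear_combination 2 * iteratedDeriv (n + 1) cosSqrt t * this
    rw [h1]
    have : 0 ≤ 8 * (n : ℝ) * iteratedDeriv (n + 1) cosSqrt t ^ 2 := by positivity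
    linarith
  have h := hanti (mem_Ici.2 le_rfl) ht ht
  simp only [mul_zero, zero_mul, add_zero] at h
  refine sq_le_sq.1 (le_trans ?_ h)
  have : 0 ≤ 4 * t * iteratedDeriv (n + 1) cosSqrt t ^ 2 := by positivity
  linarith

/-- There is a smooth function on the line with bounded derivatives which takes the value `cos x`
at `x²`. -/
theorem exists_contDiff_bounded_comp_sq_eq_cos :
    ∃ C : ℝ → ℝ, ContDiff ℝ ∞ C ∧ (∀ x, C (x ^ 2) = Real.cos x) ∧
      ∀ n : ℕ, ∃ M, ∀ t, ‖iteratedDeriv n C t‖ ≤ M := by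
  have hχ : ContDiff ℝ ∞ fun t : ℝ => Real.smoothTransition (t + 1) :=
    Real.smoothTransition.contDiff.comp (contDiff_id.add contDiff_const)
  have hC : ContDiff ℝ ∞ fun t : ℝ => Real.smoothTransition (t + 1) * cosSqrt t :=
    hχ.mul contDiff_cosSqrt
  -- Cutting off on `[-1, 0]` tames the exponential growth of `cosSqrt` at `-∞`.
  refine ⟨_, hC, fun x => ?_, fun n => ?_⟩
  · rw [Real.smoothTransition.one_of_one_le (by nlinarith [sq_nonneg x]), one_mul, cosSqrt_sq]
  · have hc : Continuous (iteratedDeriv n fun t : ℝ => Real.smoothTransition (t + 1) * cosSqrt t) :=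
      hC.continuous_iteratedDeriv n (by exact_mod_cast le_top)
    obtain ⟨M, hM⟩ := (isCompact_Icc (a := (-1 : ℝ)) (b := 0)).exists_bound_of_continuousOn
      hc.continuousOn
    refine ⟨max M |iteratedDeriv n cosSqrt 0|, fun t => ?_⟩
    rcases lt_or_ge t (-1) with ht | ht
    · have h0 : (fun t : ℝ => Real.smoothTransition (t + 1) * cosSqrt t) =ᶠ[𝓝 t] fun _ => 0 := by
        filter_upwards [gt_mem_nhds ht] with s hs
        rw [Real.smoothTransition.zero_of_nonpos (by linarith), zero_mul]
      rw [h0.iteratedDeriv_eq]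
      exact le_max_of_le_right (by simp)
    rcases le_or_gt t 0 with ht' | ht'
    · exact le_max_of_le_left (hM t ⟨ht, ht'⟩)
    · have h0 : (fun t : ℝ => Real.smoothTransition (t + 1) * cosSqrt t) =ᶠ[𝓝 t] cosSqrt := by
        filter_upwards [lt_mem_nhds ht'] with s hs
        rw [Real.smoothTransition.one_of_one_le (by linarith), one_mul]
      rw [h0.iteratedDeriv_eq]
      exact le_max_of_le_right (abs_iteratedDeriv_cosSqrt_le n ht'.le)

/-! ### Even and odd functions with parameters -/

theorem norm_iteratedFDeriv_comp_clm_le {E F : Type*} [NormedAddCommGroup E] [NormedSpace ℝ E]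
    [NormedAddCommGroup F] [NormedSpace ℝ F] {A : ℝ → F} (hA : ContDiff ℝ ∞ A) {n : ℕ} {M : ℝ}
    (hM : ∀ t, ‖iteratedDeriv n A t‖ ≤ M) (L : E →L[ℝ] ℝ) (u : E) :
    ‖iteratedFDeriv ℝ n (fun u => A (L u)) u‖ ≤ M * ‖L‖ ^ n := by
  have h := L.iteratedFDeriv_comp_right hA u (i := n) (by exact_mod_cast le_top)
  rw [show (fun u => A (L u)) = A ∘ L from rfl, h]
  refine (ContinuousMultilinearMap.norm_compContinuousLinearMap_le _ _).trans ?_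
  rw [norm_iteratedFDeriv_eq_norm_iteratedDeriv]
  simp only [Finset.prod_const, Finset.card_univ, Fintype.card_fin]
  gcongr
  exact hM _

theorem iteratedDeriv_cexp_mul_I (n : ℕ) :
    iteratedDeriv n (fun t : ℝ => Complex.exp (t * Complex.I)) =
      fun t : ℝ => Complex.I ^ n * Complex.exp (t * Complex.I) := by
  induction n with
  | zero => simp
  | succ n ih =>
    rw [iteratedDeriv_succ, ih]
    ext t
    have h1 : HasDerivAt (fun t : ℝ => (t : ℂ) * Complex.I) Complex.I t := by
      simpa using (Complex.ofRealCLM.hasDerivAt (x := t)).mul_const Complex.I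
    rw [(h1.cexp.const_mul (Complex.I ^ n)).deriv]
    ring

open MeasureTheory FourierTransform SchwartzMap in
/-- The even part in the first variable of a Schwartz function is a smooth function of the square of
that variable. Fourier inversion writes the even part as a superposition of the functions
`cos (2π x ξ) exp (2π i ⟪η, y⟫)`, and `cos (2π x ξ)` extends to a smooth function of
`x²` all of whose derivatives grow at most polynomially in `ξ`. -/
theorem SchwartzMap.exists_contDiff_even_part {Y : Type} [NormedAddCommGroup Y]
    [InnerProductSpace ℝ Y] [FiniteDimensional ℝ Y] [MeasurableSpace Y] [BorelSpace Y]
    (S : 𝓢(WithLp 2 (ℝ × Y), ℂ)) :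
    ∃ G : ℝ × Y → ℂ, ContDiff ℝ ∞ G ∧ ∀ (x : ℝ) (y : Y),
      S (WithLp.toLp 2 (x, y)) + S (WithLp.toLp 2 (-x, y)) = 2 * G (x ^ 2, y) := by
  obtain ⟨C, hC, hCcos, hCb⟩ := exists_contDiff_bounded_comp_sq_eq_cos
  choose M hM using hCb
  set P : 𝓢(WithLp 2 (ℝ × Y), ℂ) := 𝓕 S with hP
  -- With `z = (ξ, η)` the frequency and `u = (s, y)`, the even part is the integral of
  -- `P z * C (L₁ z u) * exp (i L₂ z u)`, where `L₁ z u = (2πξ)² s` and `L₂ z u = 2π ⟪η, y⟫`.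
  set L₁ : WithLp 2 (ℝ × Y) → (ℝ × Y →L[ℝ] ℝ) := fun z =>
    ((2 * Real.pi * z.fst) ^ 2) • ContinuousLinearMap.fst ℝ ℝ Y with hL₁
  set L₂ : WithLp 2 (ℝ × Y) → (ℝ × Y →L[ℝ] ℝ) := fun z =>
    (2 * Real.pi) • (innerSL ℝ z.snd).comp (ContinuousLinearMap.snd ℝ ℝ Y) with hL₂
  have hCc : ContDiff ℝ ∞ fun t => (C t : ℂ) := Complex.ofRealCLM.contDiff.comp hC
  have hE : ContDiff ℝ ∞ fun t : ℝ => Complex.exp (t * Complex.I) :=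
    (Complex.ofRealCLM.contDiff.mul contDiff_const).cexp
  have hCcM : ∀ n t, ‖iteratedDeriv n (fun t => (C t : ℂ)) t‖ ≤ M n := fun n t => by
    rw [← norm_iteratedFDeriv_eq_norm_iteratedDeriv]
    have := Complex.ofRealLI.norm_iteratedFDeriv_comp_left (hC.contDiffAt (x := t)) (i := n)
      (by exact_mod_cast le_top)
    exact (this.trans (norm_iteratedFDeriv_eq_norm_iteratedDeriv)).trans_le (hM n t)
  have hfst : ∀ z : WithLp 2 (ℝ × Y), ‖z.fst‖ ≤ ‖z‖ := fun z => by
    rw [WithLp.prod_norm_eq_of_L2]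
    exact Real.le_sqrt_of_sq_le (by nlinarith [sq_nonneg ‖z.snd‖])
  have hsnd : ∀ z : WithLp 2 (ℝ × Y), ‖z.snd‖ ≤ ‖z‖ := fun z => by
    rw [WithLp.prod_norm_eq_of_L2]
    exact Real.le_sqrt_of_sq_le (by nlinarith [sq_nonneg ‖z.fst‖])
  have hpi : 1 ≤ 2 * Real.pi := by linarith [Real.pi_gt_three]
  have hD₁ : ∀ z, ‖L₁ z‖ ≤ (2 * Real.pi) ^ 2 * (1 + ‖z‖) ^ 2 := fun z => by
    refine ContinuousLinearMap.opNorm_le_bound _ (by positivity) fun u => ?_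
    have h1 : L₁ z u = (2 * Real.pi) ^ 2 * z.fst ^ 2 * u.1 := by
      simp only [hL₁, _root_.smul_apply, ContinuousLinearMap.coe_fst', smul_eq_mul]
      ring
    rw [h1, norm_mul, norm_mul, norm_pow, norm_pow, Real.norm_of_nonneg (by positivity : 0 ≤ 2 * Real.pi)]
    gcongr
    · linarith [hfst z]
    · exact norm_fst_le u
  have hD₂ : ∀ z, ‖L₂ z‖ ≤ (2 * Real.pi) ^ 2 * (1 + ‖z‖) ^ 2 := fun z => by
    refine ContinuousLinearMap.opNorm_le_bound _ (by positivity) fun u => ?_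
    have h1 : L₂ z u = (2 * Real.pi) * inner ℝ z.snd u.2 := by simp [hL₂]
    rw [h1, norm_mul, Real.norm_of_nonneg (by positivity : 0 ≤ 2 * Real.pi)]
    calc _ ≤ (2 * Real.pi) * (‖z.snd‖ * ‖u.2‖) := by gcongr; exact norm_inner_le_norm _ _
      _ = (2 * Real.pi) * ‖z.snd‖ * ‖u.2‖ := by ring
      _ ≤ (2 * Real.pi) ^ 2 * (1 + ‖z‖) ^ 2 * ‖u‖ := by
          have := hsnd z
          have := norm_nonneg z
          gcongr
          · nlinarith
          · nlinarith
          · exact norm_snd_le u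
  set K : ℝ × Y → WithLp 2 (ℝ × Y) → ℂ := fun u z =>
    P z * ((C (L₁ z u) : ℂ) * Complex.exp ((L₂ z u : ℝ) * Complex.I)) with hK
  have hKsm : ContDiff ℝ ∞ (Function.uncurry K) := by
    have h0 : ContDiff ℝ ∞ P := P.smooth ⊤
    have h1 : ContDiff ℝ ∞ fun p : (ℝ × Y) × WithLp 2 (ℝ × Y) => L₁ p.2 p.1 := by
      have : ContDiff ℝ ∞ fun p : (ℝ × Y) × WithLp 2 (ℝ × Y) => p.2.fst :=
        (WithLp.fstL 2 ℝ ℝ Y).contDiff.comp contDiff_snd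
      simp only [hL₁, _root_.smul_apply, ContinuousLinearMap.coe_fst']
      fun_prop
    have h2 : ContDiff ℝ ∞ fun p : (ℝ × Y) × WithLp 2 (ℝ × Y) => L₂ p.2 p.1 := by
      have : ContDiff ℝ ∞ fun p : (ℝ × Y) × WithLp 2 (ℝ × Y) => p.2.snd :=
        (WithLp.sndL 2 ℝ ℝ Y).contDiff.comp contDiff_snd
      have h3 : ContDiff ℝ ∞ fun p : (ℝ × Y) × WithLp 2 (ℝ × Y) => inner ℝ p.2.snd p.1.2 :=
        this.inner ℝ (contDiff_snd.comp contDiff_fst)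
      exact contDiff_const.mul h3
    exact (h0.comp contDiff_snd).mul ((hCc.comp h1).mul (hE.comp h2))
  have hG : ContDiff ℝ ∞ fun u => ∫ z, K u z := by
    refine contDiff_integral_of_dominated hKsm fun n u₀ => ⟨1, one_pos, fun z => ‖P z‖ *
      ((∑ i ∈ Finset.range (n + 1), (n.choose i : ℝ) * M i) *
        ((2 * Real.pi) ^ 2 * (1 + ‖z‖) ^ 2) ^ n), ?_, ?_⟩
    -- The Leibniz rule bounds the `n`-th derivative of the integrand by `‖P z‖` times a polynomial
    -- in `‖z‖`, and `P` decreases rapidly.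
    · have h1 : ∀ k, Integrable fun z => (1 + ‖z‖) ^ k * ‖P z‖ := fun k => by
        simp_rw [add_comm (1 : ℝ), add_pow, Finset.sum_mul]
        refine integrable_finsetSum _ fun i _ => ?_
        refine ((P.integrable_pow_mul volume i).mul_const (k.choose i : ℝ)).congr
          (Eventually.of_forall fun z => ?_)
        simp only [one_pow]
        ring
      refine ((h1 (2 * n)).const_mul ((∑ i ∈ Finset.range (n + 1), (n.choose i : ℝ) * M i) *
        ((2 * Real.pi) ^ 2) ^ n)).congr (Eventually.of_forall fun z => ?_)
      simp only
      rw [mul_pow ((2 * Real.pi) ^ 2), ← pow_mul (1 + ‖z‖)]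
      ring
    · refine Eventually.of_forall fun z u _ => ?_
      have hs1 : ContDiff ℝ ∞ fun u => (C (L₁ z u) : ℂ) := hCc.comp (L₁ z).contDiff
      have hs2 : ContDiff ℝ ∞ fun u => Complex.exp ((L₂ z u : ℝ) * Complex.I) :=
        hE.comp (L₂ z).contDiff
      have h1 : iteratedFDeriv ℝ n (fun u => K u z) u = P z • iteratedFDeriv ℝ n
          (fun u => (C (L₁ z u) : ℂ) * Complex.exp ((L₂ z u : ℝ) * Complex.I)) u :=
        iteratedFDeriv_const_smul_apply (a := P z)
          ((hs1.mul hs2).contDiffAt.of_le (by exact_mod_cast le_top))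
      rw [h1, norm_smul]
      refine mul_le_mul_of_nonneg_left ?_ (norm_nonneg _)
      refine (norm_iteratedFDeriv_mul_le hs1 hs2 u (n := n) (by exact_mod_cast le_top)).trans ?_
      rw [Finset.sum_mul]
      refine Finset.sum_le_sum fun i hi => ?_
      have hi' : i ≤ n := Nat.lt_succ_iff.1 (Finset.mem_range.1 hi)
      have b1 := norm_iteratedFDeriv_comp_clm_le hCc (hCcM i) (L₁ z) u
      have b2 := norm_iteratedFDeriv_comp_clm_le hE (n := n - i) (M := 1) (fun t => by
        rw [iteratedDeriv_cexp_mul_I]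
        simp [Complex.norm_exp_ofReal_mul_I]) (L₂ z) u
      have hMi : 0 ≤ M i := (norm_nonneg _).trans (hM i 0)
      calc _ ≤ (n.choose i : ℝ) * (M i * ‖L₁ z‖ ^ i) * (1 * ‖L₂ z‖ ^ (n - i)) := by gcongr
        _ ≤ (n.choose i : ℝ) * (M i * ((2 * Real.pi) ^ 2 * (1 + ‖z‖) ^ 2) ^ i) *
            (1 * ((2 * Real.pi) ^ 2 * (1 + ‖z‖) ^ 2) ^ (n - i)) := by
          gcongr
          · exact hD₁ z
          · exact hD₂ z
        _ = _ := by
          rw [← pow_mul_pow_sub _ hi']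
          ring
  refine ⟨_, hG, fun x y => ?_⟩
  -- Fourier inversion; adding the values at `x` and `-x` turns `exp (2πi ξ x)` into a cosine.
  have hinv : ∀ w, S w = ∫ z, Complex.exp ((2 * Real.pi * inner ℝ z w : ℝ) * Complex.I) * P z :=
    fun w => by
      have h1 : 𝓕⁻ (𝓕 S : 𝓢(WithLp 2 (ℝ × Y), ℂ)) = S := by simp
      have h2 := congrArg (fun T : 𝓢(WithLp 2 (ℝ × Y), ℂ) => T w) h1
      simp only [SchwartzMap.fourierInv_coe] at h2
      rw [Real.fourierInv_eq'] at h2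
      simpa using h2.symm
  have hint : ∀ w, Integrable fun z =>
      Complex.exp ((2 * Real.pi * inner ℝ z w : ℝ) * Complex.I) * P z := fun w => by
    refine (P.integrable (μ := volume)).norm.mono' ?_ (Eventually.of_forall fun z => ?_)
    · refine Continuous.aestronglyMeasurable ?_
      have : Continuous P := P.continuous
      fun_prop
    · rw [norm_mul, Complex.norm_exp_ofReal_mul_I, one_mul]
  rw [hinv, hinv, ← integral_add (hint _) (hint _), ← integral_const_mul]
  refine integral_congr_ae (Eventually.of_forall fun z => ?_)
  have e1 : L₁ z (x ^ 2, y) = (2 * Real.pi * z.fst * x) ^ 2 := by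
    simp [hL₁]; ring
  simp only [hK, e1, hCcos, WithLp.prod_inner_apply]
  have e2 : ∀ a b : ℝ, 2 * Real.pi * (a + b) = 2 * Real.pi * b + 2 * Real.pi * a := fun a b => by
    ring
  have e3 : L₂ z (x ^ 2, y) = 2 * Real.pi * inner ℝ z.snd y := by simp [hL₂]
  rw [e3, Complex.ofReal_cos, e2, e2]
  push_cast
  rw [add_mul, add_mul, Complex.exp_add, Complex.exp_add, Complex.cos]
  have e4 : inner ℝ z.fst x = z.fst * x := by simp [mul_comm]
  have e5 : inner ℝ z.fst (-x) = - (z.fst * x) := by simp [mul_comm]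
  change Complex.exp (2 * ↑Real.pi * ↑(inner ℝ z.snd y) * Complex.I) *
      Complex.exp (2 * ↑Real.pi * ↑(inner ℝ z.fst x) * Complex.I) * P z +
    Complex.exp (2 * ↑Real.pi * ↑(inner ℝ z.snd y) * Complex.I) *
      Complex.exp (2 * ↑Real.pi * ↑(inner ℝ z.fst (-x)) * Complex.I) * P z = _
  rw [e4, e5]
  push_cast
  have e6 : 2 * (Real.pi : ℂ) * -((z.fst : ℂ) * x) = -(2 * Real.pi * z.fst * x) := by ring
  have e7 : 2 * (Real.pi : ℂ) * ((z.fst : ℂ) * x) = 2 * Real.pi * z.fst * x := by ring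
  rw [e6, e7]
  ring

/-- The even part in the first variable of a smooth function is near the origin a smooth function of
the square of that variable. -/
theorem exists_contDiff_even_part {Y : Type} [NormedAddCommGroup Y] [InnerProductSpace ℝ Y]
    [FiniteDimensional ℝ Y] {f : ℝ × Y → ℝ} (hf : ContDiff ℝ ∞ f) :
    ∃ G : ℝ × Y → ℝ, ContDiff ℝ ∞ G ∧
      ∀ᶠ u in 𝓝 (0 : ℝ × Y), f u + f (-u.1, u.2) = 2 * G (u.1 ^ 2, u.2) := by
  borelize Y
  let χ : ContDiffBump (0 : ℝ × Y) := ⟨1, 2, one_pos, one_lt_two⟩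
  have h1 : ContDiff ℝ ∞ fun w : WithLp 2 (ℝ × Y) => ((χ w.ofLp * f w.ofLp : ℝ) : ℂ) :=
    Complex.ofRealCLM.contDiff.comp
      ((χ.contDiff.mul hf).comp (WithLp.prodContinuousLinearEquiv 2 ℝ ℝ Y).contDiff)
  have h2 : HasCompactSupport fun w : WithLp 2 (ℝ × Y) => ((χ w.ofLp * f w.ofLp : ℝ) : ℂ) := by
    have h3 : HasCompactSupport fun w : ℝ × Y => ((χ w * f w : ℝ) : ℂ) :=
      (χ.hasCompactSupport.mul_right (f' := f)).comp_left (g := Complex.ofReal) (by simp)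
    exact h3.comp_homeomorph (WithLp.prodContinuousLinearEquiv 2 ℝ ℝ Y).toHomeomorph
  obtain ⟨G, hG, hGS⟩ := (h2.toSchwartzMap h1).exists_contDiff_even_part
  refine ⟨fun u => (G u).re, Complex.reCLM.contDiff.comp hG, ?_⟩
  have h4 : ∀ᶠ u in 𝓝 (0 : ℝ × Y), χ u = 1 := χ.eventuallyEq_one
  have h5 : Tendsto (fun u : ℝ × Y => (-u.1, u.2)) (𝓝 0) (𝓝 0) := by
    have : Continuous fun u : ℝ × Y => (-u.1, u.2) := by fun_prop
    exact this.tendsto' 0 0 (by ext <;> simp)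
  filter_upwards [h4, h5.eventually h4] with u hu hu'
  have := congrArg Complex.re (hGS u.1 u.2)
  simpa [hu, hu'] using this

/-- Near the origin, a smooth function splits into an even and an odd part with respect to the first
variable `x`, of the form `a (x², y)` and `x * b (x², y)` with `a` and `b` smooth. -/
theorem exists_contDiff_even_add_odd {Y : Type} [NormedAddCommGroup Y] [InnerProductSpace ℝ Y]
    [FiniteDimensional ℝ Y] {f : ℝ × Y → ℝ} (hf : ContDiff ℝ ∞ f) :
    ∃ a b : ℝ × Y → ℝ, ContDiff ℝ ∞ a ∧ ContDiff ℝ ∞ b ∧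
      ∀ᶠ u in 𝓝 (0 : ℝ × Y), f u = a (u.1 ^ 2, u.2) + u.1 * b (u.1 ^ 2, u.2) := by
  obtain ⟨a, ha, haf⟩ := exists_contDiff_even_part hf
  obtain ⟨g, hg, hgf⟩ := exists_contDiff_eq_add_smul hf
  obtain ⟨b, hb, hbg⟩ := exists_contDiff_even_part hg
  -- With `f u = f (0, y) + x g u`, the odd part of `f` is `x` times the even part of `g`.
  refine ⟨a, b, ha, hb, ?_⟩
  filter_upwards [haf, hbg] with u hu hu'
  have h1 := hgf u
  have h2 := hgf (-u.1, u.2)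
  simp only [smul_eq_mul] at h1 h2
  linear_combination hu / 2 + u.1 / 2 * hu' + h1 / 2 - h2 / 2

/-- The vector-valued version of `exists_contDiff_even_add_odd`. -/
theorem exists_contDiff_even_add_odd_smul {Y Z : Type} [NormedAddCommGroup Y]
    [InnerProductSpace ℝ Y] [FiniteDimensional ℝ Y] [NormedAddCommGroup Z] [NormedSpace ℝ Z]
    [FiniteDimensional ℝ Z] {f : ℝ × Y → Z} (hf : ContDiff ℝ ∞ f) :
    ∃ a b : ℝ × Y → Z, ContDiff ℝ ∞ a ∧ ContDiff ℝ ∞ b ∧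
      ∀ᶠ u in 𝓝 (0 : ℝ × Y), f u = a (u.1 ^ 2, u.2) + u.1 • b (u.1 ^ 2, u.2) := by
  choose a b ha hb hab using fun i => exists_contDiff_even_add_odd
    ((contDiff_piLp 2).1 ((toEuclidean (E := Z)).contDiff.comp hf) i)
  refine ⟨fun u => toEuclidean.symm (WithLp.toLp 2 fun i => a i u),
    fun u => toEuclidean.symm (WithLp.toLp 2 fun i => b i u),
    toEuclidean.symm.contDiff.comp ((contDiff_piLp 2).2 ha),
    toEuclidean.symm.contDiff.comp ((contDiff_piLp 2).2 hb), ?_⟩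
  filter_upwards [eventually_all.2 hab] with u hu
  rw [← map_smul, ← map_add, ContinuousLinearEquiv.eq_symm_apply]
  ext i
  simpa using hu i

/-! ### Germs of maps up to changes of coordinates -/

section Germs

variable {E E' E'' F F' F'' : Type*} [NormedAddCommGroup E] [NormedSpace ℝ E]
  [NormedAddCommGroup E'] [NormedSpace ℝ E'] [NormedAddCommGroup E''] [NormedSpace ℝ E'']
  [NormedAddCommGroup F] [NormedSpace ℝ F] [NormedAddCommGroup F'] [NormedSpace ℝ F']
  [NormedAddCommGroup F''] [NormedSpace ℝ F'']

/-- `f` is smooth on a neighbourhood of `x`. (`ContDiffAt ℝ ∞ f x` is weaker: there the neighbourhood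
may shrink with the order of differentiability.) -/
def SmoothNear (f : E → F) (x : E) : Prop := ∀ᶠ y in 𝓝 x, ContDiffAt ℝ ∞ f y

theorem ContDiff.smoothNear {f : E → F} (hf : ContDiff ℝ ∞ f) (x : E) : SmoothNear f x :=
  Eventually.of_forall fun _ => hf.contDiffAt

theorem SmoothNear.contDiffAt {f : E → F} {x : E} (hf : SmoothNear f x) : ContDiffAt ℝ ∞ f x :=
  hf.self_of_nhds

theorem ContDiffOn.smoothNear {f : E → F} {s : Set E} (hf : ContDiffOn ℝ ∞ f s) (hs : IsOpen s)
    {x : E} (hx : x ∈ s) : SmoothNear f x := by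
  filter_upwards [hs.mem_nhds hx] with y hy using hf.contDiffAt (hs.mem_nhds hy)

theorem SmoothNear.comp {g : F → F'} {f : E → F} {x : E} (hg : SmoothNear g (f x))
    (hf : SmoothNear f x) : SmoothNear (fun y => g (f y)) x := by
  filter_upwards [hf, hf.contDiffAt.continuousAt.eventually hg] with y h1 h2 using h2.comp y h1

/-- A germ of a smooth map is represented by a globally smooth map. -/
theorem SmoothNear.exists_contDiff [FiniteDimensional ℝ E] {f : E → F} {x : E}
    (hf : SmoothNear f x) : ∃ g : E → F, ContDiff ℝ ∞ g ∧ g =ᶠ[𝓝 x] f := by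
  obtain ⟨r, hr, hrf⟩ := Metric.eventually_nhds_iff_ball.1 hf
  let χ : ContDiffBump x := ⟨r / 3, r / 2, by positivity, by linarith⟩
  refine ⟨fun y => χ y • f y, contDiff_iff_contDiffAt.2 fun y => ?_, ?_⟩
  · by_cases hy : y ∈ tsupport χ
    · refine χ.contDiff.contDiffAt.smul (hrf y ?_)
      rw [χ.tsupport_eq] at hy
      exact Metric.closedBall_subset_ball (show r / 2 < r by linarith) hy
    · refine (contDiffAt_const (c := (0 : F))).congr_of_eventuallyEq ?_
      filter_upwards [notMem_tsupport_iff_eventuallyEq.1 hy] with z hz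
      simp [hz]
  · filter_upwards [χ.eventuallyEq_one] with y hy
    simp [hy]

/-- A smooth coordinate system has an invertible differential. -/
theorem IsSmoothCoordinates.exists_hasFDerivAt {φ : OpenPartialHomeomorph E F}
    (hφ : IsSmoothCoordinates φ) {x : E} (hx : x ∈ φ.source) :
    ∃ A : E ≃L[ℝ] F, HasFDerivAt φ (A : E →L[ℝ] F) x := by
  have h1 : HasFDerivAt φ (fderiv ℝ φ x) x :=
    ((hφ.1.contDiffAt (φ.open_source.mem_nhds hx)).differentiableAt (by simp)).hasFDerivAt
  have hx' := φ.map_source hx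
  have h2 : HasFDerivAt φ.symm (fderiv ℝ φ.symm (φ x)) (φ x) :=
    ((hφ.2.contDiffAt (φ.open_target.mem_nhds hx')).differentiableAt (by simp)).hasFDerivAt
  have h3 := (h2.comp x h1).congr_of_eventuallyEq (f₁ := id) (by
    filter_upwards [φ.open_source.mem_nhds hx] with y hy using (φ.left_inv hy).symm)
  have h1' : HasFDerivAt φ (fderiv ℝ φ x) (φ.symm (φ x)) := by rwa [φ.left_inv hx]
  have h4 := (h1'.comp (φ x) h2).congr_of_eventuallyEq (f₁ := id) (by
    filter_upwards [φ.open_target.mem_nhds hx'] with y hy using (φ.right_inv hy).symm)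
  have h5 := h3.unique (hasFDerivAt_id x)
  have h6 := h4.unique (hasFDerivAt_id (φ x))
  exact ⟨ContinuousLinearEquiv.equivOfInverse (fderiv ℝ φ x) (fderiv ℝ φ.symm (φ x))
    (fun v => DFunLike.congr_fun h5 v) (fun v => DFunLike.congr_fun h6 v), h1⟩

theorem IsSmoothCoordinates.smoothNear {φ : OpenPartialHomeomorph E F}
    (hφ : IsSmoothCoordinates φ) {x : E} (hx : x ∈ φ.source) : SmoothNear φ x :=
  hφ.1.smoothNear φ.open_source hx

theorem IsSmoothCoordinates.symm {φ : OpenPartialHomeomorph E F}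
    (hφ : IsSmoothCoordinates φ) : IsSmoothCoordinates φ.symm := ⟨hφ.2, by simpa using hφ.1⟩

theorem IsSmoothCoordinates.trans {φ : OpenPartialHomeomorph E F}
    {ψ : OpenPartialHomeomorph F F'} (hφ : IsSmoothCoordinates φ) (hψ : IsSmoothCoordinates ψ) :
    IsSmoothCoordinates (φ.trans ψ) := by
  refine ⟨?_, ?_⟩
  · refine hψ.1.comp (hφ.1.mono ?_) ?_
    · rw [φ.trans_source]; exact inter_subset_left
    · rw [φ.trans_source]; exact fun x hx => hx.2
  · refine hφ.2.comp (hψ.2.mono ?_) ?_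
    · rw [φ.trans_target]; exact inter_subset_left
    · rw [φ.trans_target]; exact fun x hx => hx.2

theorem isSmoothCoordinates_refl : IsSmoothCoordinates (OpenPartialHomeomorph.refl E) :=
  ⟨contDiffOn_id, contDiffOn_id⟩

/-- The inverse function theorem for germs of smooth maps. -/
theorem SmoothNear.exists_isSmoothCoordinates [FiniteDimensional ℝ E] {f : E → F} {x : E}
    (hf : SmoothNear f x) {A : E ≃L[ℝ] F} (hA : HasFDerivAt f (A : E →L[ℝ] F) x) :
    ∃ φ : OpenPartialHomeomorph E F, IsSmoothCoordinates φ ∧ x ∈ φ.source ∧ ⇑φ = f := by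
  have : CompleteSpace E := FiniteDimensional.complete ℝ E
  let e := hf.contDiffAt.toOpenPartialHomeomorph f hA (by simp)
  have he : x ∈ e.source := hf.contDiffAt.mem_toOpenPartialHomeomorph_source hA (by simp)
  have hinv : ∀ᶠ y in 𝓝 x, fderiv ℝ f y ∈ range ((↑) : (E ≃L[ℝ] F) → E →L[ℝ] F) := by
    have hc : ContinuousAt (fderiv ℝ f) x :=
      ((hf.contDiffAt.fderiv_right (m := 0) (by simp)).continuousAt)
    refine hc.eventually (ContinuousLinearEquiv.isOpen.mem_nhds ?_)
    rw [hA.fderiv]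
    exact ⟨A, rfl⟩
  obtain ⟨s, hs, hso, hxs⟩ := eventually_nhds_iff.1 (hf.and hinv)
  refine ⟨e.restrOpen s hso, ⟨fun y hy => ?_, fun z hz => ?_⟩, ⟨he, hxs⟩, rfl⟩
  · exact (hs y hy.2).1.contDiffWithinAt
  · have hz' : e.symm z ∈ s := hz.2
    obtain ⟨h1, B, hB⟩ := hs _ hz'
    have h2 : HasFDerivAt e (B : E →L[ℝ] F) (e.symm z) := by
      rw [hB]
      exact (h1.differentiableAt (by simp)).hasFDerivAt
    exact (e.contDiffAt_symm hz.1 h2 h1).contDiffWithinAt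

/-- A smooth map can be transported along a smooth coordinate system of its source, up to passing to
another representative of the germ. -/
theorem IsSmoothCoordinates.exists_contDiff_comp [FiniteDimensional ℝ E']
    {φ : OpenPartialHomeomorph E E'} (hφ : IsSmoothCoordinates φ) {x : E} (hx : x ∈ φ.source)
    {g : E → F} (hg : SmoothNear g x) :
    ∃ g' : E' → F, ContDiff ℝ ∞ g' ∧ ∀ᶠ y in 𝓝 x, g' (φ y) = g y := by
  have h1 : SmoothNear (fun z => g (φ.symm z)) (φ x) := by
    refine SmoothNear.comp ?_ (hφ.symm.smoothNear (φ.map_source hx))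
    rwa [φ.left_inv hx]
  obtain ⟨g', hg', hgg⟩ := h1.exists_contDiff
  refine ⟨g', hg', ?_⟩
  filter_upwards [(φ.continuousAt hx).eventually hgg, φ.open_source.mem_nhds hx] with y h2 h3
  rw [h2, φ.left_inv h3]

/-- The germ of `g` at `x` is carried to the germ of `g'` at `x'` by smooth coordinate changes of
source and target. -/
def GermEquiv (g : E → F) (x : E) (g' : E' → F') (x' : E') : Prop :=
  ∃ (φ : OpenPartialHomeomorph E E') (ψ : OpenPartialHomeomorph F F'),
    IsSmoothCoordinates φ ∧ x ∈ φ.source ∧ φ x = x' ∧ IsSmoothCoordinates ψ ∧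
      ∀ᶠ y in 𝓝 x, g y ∈ ψ.source ∧ ψ (g y) = g' (φ y)

theorem GermEquiv.trans {g : E → F} {x : E} {g' : E' → F'} {x' : E'} {g'' : E'' → F''} {x'' : E''}
    (h : GermEquiv g x g' x') (h' : GermEquiv g' x' g'' x'') : GermEquiv g x g'' x'' := by
  obtain ⟨φ, ψ, hφ, hx, rfl, hψ, hg⟩ := h
  obtain ⟨φ', ψ', hφ', hx', rfl, hψ', hg'⟩ := h'
  refine ⟨φ.trans φ', ψ.trans ψ', hφ.trans hφ', ?_, rfl, hψ.trans hψ', ?_⟩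
  · rw [φ.trans_source]
    exact ⟨hx, hx'⟩
  · filter_upwards [hg, (φ.continuousAt hx).eventually hg'] with y h1 h2
    rw [ψ.trans_source]
    exact ⟨⟨h1.1, by rw [mem_preimage, h1.2]; exact h2.1⟩, by
      simp only [OpenPartialHomeomorph.coe_trans, Function.comp_apply]
      rw [h1.2, h2.2]⟩

/-- By the inverse function theorem, smooth maps with invertible differentials serve as coordinate
changes. -/
theorem GermEquiv.of_hasFDerivAt [FiniteDimensional ℝ E] [FiniteDimensional ℝ F] {g : E → F} {x : E}
    {g' : E' → F'} {x' : E'} {a : E → E'} {b : F → F'} {A : E ≃L[ℝ] E'} {B : F ≃L[ℝ] F'}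
    (hg : ContinuousAt g x) (ha : SmoothNear a x) (hA : HasFDerivAt a (A : E →L[ℝ] E') x)
    (hx : a x = x') (hb : SmoothNear b (g x)) (hB : HasFDerivAt b (B : F →L[ℝ] F') (g x))
    (h : ∀ᶠ y in 𝓝 x, b (g y) = g' (a y)) : GermEquiv g x g' x' := by
  obtain ⟨φ, hφ, hxφ, rfl⟩ := ha.exists_isSmoothCoordinates hA
  obtain ⟨ψ, hψ, hxψ, rfl⟩ := hb.exists_isSmoothCoordinates hB
  exact ⟨φ, ψ, hφ, hxφ, hx, hψ, (hg.eventually (ψ.open_source.mem_nhds hxψ)).and h⟩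

/-- The second-order chain rule. -/
theorem fderiv_fderiv_comp {a : F → F'} {b : E → F} {x : E} (ha : ContDiffAt ℝ ∞ a (b x))
    (hb : ContDiffAt ℝ ∞ b x) (v w : E) :
    fderiv ℝ (fderiv ℝ fun y => a (b y)) x v w =
      fderiv ℝ (fderiv ℝ a) (b x) (fderiv ℝ b x v) (fderiv ℝ b x w) +
        fderiv ℝ a (b x) (fderiv ℝ (fderiv ℝ b) x v w) := by
  have hb1 : ∀ᶠ y in 𝓝 x, ContDiffAt ℝ 1 b y :=
    (hb.of_le (by exact_mod_cast le_top)).eventually (by simp)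
  have ha1 : ∀ᶠ z in 𝓝 (b x), ContDiffAt ℝ 1 a z :=
    (ha.of_le (by exact_mod_cast le_top)).eventually (by simp)
  have h1 : (fderiv ℝ fun y => a (b y)) =ᶠ[𝓝 x] fun y => (fderiv ℝ a (b y)).comp (fderiv ℝ b y) := by
    filter_upwards [hb1, hb.continuousAt.eventually ha1] with y h2 h3
    exact fderiv_comp y (h3.differentiableAt one_ne_zero) (h2.differentiableAt one_ne_zero)
  have h2 : DifferentiableAt ℝ (fderiv ℝ a) (b x) :=
    (ha.fderiv_right (m := 1) (by norm_cast)).differentiableAt one_ne_zero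
  have h3 : DifferentiableAt ℝ (fderiv ℝ b) x :=
    (hb.fderiv_right (m := 1) (by norm_cast)).differentiableAt one_ne_zero
  have h4 := (h2.hasFDerivAt.comp x (hb.differentiableAt (by simp)).hasFDerivAt).clm_comp
    h3.hasFDerivAt
  rw [h1.fderiv_eq]
  change fderiv ℝ (fun y => ((fderiv ℝ a ∘ b) y).comp (fderiv ℝ b y)) x v w = _
  rw [h4.fderiv]
  simp [add_comm]

/-- `x` is a Whitney point of `g` if the kernel of the differential of `g` at `x` is a line, and the
intrinsic second derivative maps the tensor product of the source with this line onto the cokernel of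
the differential. -/
def IsWhitneyPoint (g : E → F) (x : E) : Prop :=
  ∃ k : E, k ≠ 0 ∧ (∀ v : E, fderiv ℝ g x v = 0 ↔ ∃ c : ℝ, v = c • k) ∧
    ∀ w : F, ∃ v u : E, fderiv ℝ (fderiv ℝ g) x v k + fderiv ℝ g x u = w

/-- Being a Whitney point is invariant under coordinate changes. -/
theorem IsWhitneyPoint.of_germEquiv {g : E → F} {x : E} {g' : E' → F'} {x' : E'}
    (h : IsWhitneyPoint g x) (he : GermEquiv g x g' x') (hg : ContDiffAt ℝ ∞ g x)
    (hg' : ContDiffAt ℝ ∞ g' x') : IsWhitneyPoint g' x' := by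
  obtain ⟨φ, ψ, hφ, hx, rfl, hψ, he⟩ := he
  obtain ⟨k, hk0, hk, hsurj⟩ := h
  have hgx : g x ∈ ψ.source := he.self_of_nhds.1
  have hφx := (hφ.smoothNear hx).contDiffAt
  have hψx := (hψ.smoothNear hgx).contDiffAt
  obtain ⟨A, hA⟩ := hφ.exists_hasFDerivAt hx
  obtain ⟨B, hB⟩ := hψ.exists_hasFDerivAt hgx
  have he' : (fun y => ψ (g y)) =ᶠ[𝓝 x] fun y => g' (φ y) := he.mono fun y hy => hy.2
  have h1 : ∀ v, B (fderiv ℝ g x v) = fderiv ℝ g' (φ x) (A v) := fun v => by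
    have h2 := (hB.comp x (hg.differentiableAt (by simp)).hasFDerivAt).congr_of_eventuallyEq he'.symm
    have h3 := (hg'.differentiableAt (by simp)).hasFDerivAt.comp x hA
    exact DFunLike.congr_fun (h2.unique h3) v
  have h2 : ∀ v, B (fderiv ℝ (fderiv ℝ g) x v k) = fderiv ℝ (fderiv ℝ g') (φ x) (A v) (A k) +
      fderiv ℝ g' (φ x) (fderiv ℝ (fderiv ℝ φ) x v k) := fun v => by
    have h3 := fderiv_fderiv_comp hψx hg v k
    rw [he'.fderiv.fderiv_eq, fderiv_fderiv_comp hg' hφx, (hk k).2 ⟨1, by simp⟩, map_zero, zero_add,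
      hA.fderiv, hB.fderiv] at h3
    exact h3.symm
  refine ⟨A k, by simpa using hk0, fun v => ?_, fun w => ?_⟩
  · have h3 := h1 (A.symm v)
    rw [A.apply_symm_apply] at h3
    rw [← h3, map_eq_zero_iff _ B.injective, hk]
    refine exists_congr fun c => ?_
    rw [← map_smul, A.symm_apply_eq]
  · obtain ⟨v, u, hvu⟩ := hsurj (B.symm w)
    refine ⟨A v, fderiv ℝ (fderiv ℝ φ) x v k + A u, ?_⟩
    rw [map_add, ← add_assoc, ← h2, ← h1, ← map_add, hvu, B.apply_symm_apply]

end Germs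

/-! ### Whitney points and the Whitney umbrella -/

theorem ContinuousLinearMap.exists_equiv_of_injective {E F : Type*} [NormedAddCommGroup E]
    [NormedSpace ℝ E] [FiniteDimensional ℝ E] [NormedAddCommGroup F] [NormedSpace ℝ F]
    [FiniteDimensional ℝ F] (L : E →L[ℝ] F) (hL : ∀ v, L v = 0 → v = 0)
    (h : Module.finrank ℝ E = Module.finrank ℝ F) :
    ∃ A : E ≃L[ℝ] F, (A : E →L[ℝ] F) = L :=
  ⟨(LinearEquiv.ofInjectiveOfFinrankEq L.toLinearMap
    ((injective_iff_map_eq_zero L).2 hL) h).toContinuousLinearEquiv, by ext; rfl⟩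

/-- A variant of `GermEquiv.of_hasFDerivAt` for spaces of equal dimensions, where it is enough that
the differentials are injective. -/
theorem GermEquiv.of_injective {E E' F F' : Type*} [NormedAddCommGroup E] [NormedSpace ℝ E]
    [NormedAddCommGroup E'] [NormedSpace ℝ E'] [NormedAddCommGroup F] [NormedSpace ℝ F]
    [NormedAddCommGroup F'] [NormedSpace ℝ F'] [FiniteDimensional ℝ E] [FiniteDimensional ℝ F]
    [FiniteDimensional ℝ E'] [FiniteDimensional ℝ F']
    (hE : Module.finrank ℝ E = Module.finrank ℝ E') (hF : Module.finrank ℝ F = Module.finrank ℝ F')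
    {g : E → F} {x : E} {g' : E' → F'} {x' : E'} {a : E → E'} {b : F → F'}
    (hg : ContinuousAt g x) (ha : SmoothNear a x) (hA : ∀ v, fderiv ℝ a x v = 0 → v = 0)
    (hx : a x = x') (hb : SmoothNear b (g x)) (hB : ∀ v, fderiv ℝ b (g x) v = 0 → v = 0)
    (h : ∀ᶠ y in 𝓝 x, b (g y) = g' (a y)) : GermEquiv g x g' x' := by
  obtain ⟨A, hA'⟩ := (fderiv ℝ a x).exists_equiv_of_injective hA hE
  obtain ⟨B, hB'⟩ := (fderiv ℝ b (g x)).exists_equiv_of_injective hB hF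
  refine GermEquiv.of_hasFDerivAt (A := A) (B := B) hg ha ?_ hx hb ?_ h
  · rw [hA']; exact (ha.contDiffAt.differentiableAt (by simp)).hasFDerivAt
  · rw [hB']; exact (hb.contDiffAt.differentiableAt (by simp)).hasFDerivAt

section NormalForm

variable {Y : Type} [NormedAddCommGroup Y] [InnerProductSpace ℝ Y]

/-- The cross-cap `(x, y) ↦ (y, x², x y)`, with the coordinates of the target ordered so that the
tangential part comes first. -/
def whitneyUmbrella (u : ℝ × Y) : Y × (ℝ × Y) := (u.2, (u.1 ^ 2, u.1 • u.2))

theorem contDiff_whitneyUmbrella : ContDiff ℝ ∞ (whitneyUmbrella : ℝ × Y → Y × (ℝ × Y)) := by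
  unfold whitneyUmbrella
  fun_prop

/-- If `β` is stationary along the first axis at the origin, as it is when it depends on `x²` and `y`
only, then the origin is a Whitney point of `(x, y) ↦ (y, x², x β (x, y))` if and only if `β` vanishes
there and its partial differential in `y` is onto. -/
theorem isWhitneyPoint_iff_of_odd {β : ℝ × Y → Y} (hβ : ContDiff ℝ ∞ β)
    (hβ0 : fderiv ℝ β 0 (1, 0) = 0) :
    IsWhitneyPoint (fun u : ℝ × Y => (u.2, (u.1 ^ 2, u.1 • β u))) 0 ↔
      β 0 = 0 ∧ Function.Surjective fun y => fderiv ℝ β 0 (0, y) := by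
  have hg : ContDiff ℝ ∞ fun u : ℝ × Y => (u.2, (u.1 ^ 2, u.1 • β u)) := by fun_prop
  have h1 : ∀ u v : ℝ × Y, fderiv ℝ (fun u : ℝ × Y => (u.2, (u.1 ^ 2, u.1 • β u))) u v =
      (v.2, (2 * u.1 * v.1, u.1 • fderiv ℝ β u v + v.1 • β u)) := fun u v => by
    have hb := (hβ.differentiable (by simp) u).hasFDerivAt
    have := (hasFDerivAt_snd (𝕜 := ℝ) (p := u)).prodMk
      (((hasFDerivAt_fst (𝕜 := ℝ) (p := u)).pow 2).prodMk
        ((hasFDerivAt_fst (𝕜 := ℝ) (p := u)).smul hb))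
    erw [this.fderiv]
    simp
  have h2 : ∀ v : ℝ × Y,
      fderiv ℝ (fderiv ℝ fun u : ℝ × Y => (u.2, (u.1 ^ 2, u.1 • β u))) 0 v (1, 0) =
        (0, (2 * v.1, fderiv ℝ β 0 v)) := fun v => by
    have hD : DifferentiableAt ℝ (fderiv ℝ fun u : ℝ × Y => (u.2, (u.1 ^ 2, u.1 • β u))) 0 :=
      (hg.fderiv_right (m := 1) (by norm_cast)).differentiable one_ne_zero 0
    have h3 := hD.hasFDerivAt.clm_apply (hasFDerivAt_const ((1, 0) : ℝ × Y) 0)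
    have h4 : (fun u => fderiv ℝ (fun u : ℝ × Y => (u.2, (u.1 ^ 2, u.1 • β u))) u (1, 0)) =
        fun u : ℝ × Y => ((0 : Y), (2 * u.1, u.1 • fderiv ℝ β u (1, 0) + β u)) := by
      ext u <;> simp [h1]
    rw [h4] at h3
    have hb := (hβ.differentiable (by simp) 0).hasFDerivAt
    have hb' := ((hβ.fderiv_right (m := 1) (by norm_cast)).differentiable one_ne_zero
      0).hasFDerivAt.clm_apply (hasFDerivAt_const ((1, 0) : ℝ × Y) 0)
    have h5 := (hasFDerivAt_const (0 : Y) (0 : ℝ × Y)).prodMk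
      (((hasFDerivAt_fst (𝕜 := ℝ) (p := (0 : ℝ × Y))).const_mul 2).prodMk
        (((hasFDerivAt_fst (𝕜 := ℝ) (p := (0 : ℝ × Y))).smul hb').add hb))
    have h6 := DFunLike.congr_fun (h3.unique h5) v
    simpa [hβ0] using h6
  constructor
  · rintro ⟨k, hk0, hk, hs⟩
    have h3 := (hk k).2 ⟨1, by simp⟩
    simp only [h1, Prod.mk_eq_zero, Prod.fst_zero, zero_smul, zero_add] at h3
    obtain ⟨hk2, -, hk1⟩ := h3
    have hk1' : k.1 ≠ 0 := fun h => hk0 (Prod.ext h hk2)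
    have hβz : β 0 = 0 := (smul_eq_zero.1 hk1).resolve_left hk1'
    refine ⟨hβz, fun w => ?_⟩
    obtain ⟨v, u, hvu⟩ := hs (0, (0, w))
    have hk' : k = k.1 • ((1, 0) : ℝ × Y) := by ext <;> simp [hk2]
    rw [hk', map_smul, h2, h1] at hvu
    simp only [hβz, Prod.smul_mk, Prod.mk_add_mk, Prod.mk.injEq, smul_zero, Prod.fst_zero, zero_smul,
      add_zero] at hvu
    have hv1 : v.1 = 0 := by
      have := hvu.2.1
      simpa [hk1'] using this
    refine ⟨k.1 • v.2, ?_⟩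
    rw [← hvu.2.2, ← map_smul]
    exact congrArg _ (Prod.ext (by simp [hv1]) (by simp))
  · rintro ⟨hβz, hs⟩
    refine ⟨(1, 0), by simp, fun v => ?_, fun w => ?_⟩
    · rw [h1]
      simp only [hβz, Prod.mk_eq_zero, Prod.fst_zero, zero_smul, zero_add, smul_zero, mul_zero,
        zero_mul, and_true]
      refine ⟨fun h => ⟨v.1, by ext <;> simp [h]⟩, ?_⟩
      rintro ⟨c, rfl⟩
      simp
    · obtain ⟨y, hy⟩ := hs w.2.2
      refine ⟨(w.2.1 / 2, y), (0, w.1), ?_⟩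
      rw [h2, h1]
      have h3 : ((w.2.1 / 2, y) : ℝ × Y) = (w.2.1 / 2) • (1, 0) + (0, y) := by ext <;> simp
      rw [h3, map_add, map_smul, hβ0]
      refine Prod.ext (by simp) (Prod.ext ?_ ?_)
      · simp only [Prod.snd_add, Prod.fst_add, Prod.fst_zero]
        ring_nf
        simp
      · simpa using hy

theorem isWhitneyPoint_whitneyUmbrella :
    IsWhitneyPoint (whitneyUmbrella : ℝ × Y → Y × (ℝ × Y)) 0 := by
  have h : fderiv ℝ (Prod.snd : ℝ × Y → Y) 0 = ContinuousLinearMap.snd ℝ ℝ Y :=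
    hasFDerivAt_snd.fderiv
  exact (isWhitneyPoint_iff_of_odd contDiff_snd (by simp [h])).2
    ⟨rfl, fun y => ⟨y, by simp [h]⟩⟩

/-- A Whitney point of a map `(x, y) ↦ (y, x², d (x, y))` is a cross-cap. The even part of `d` is a
function of `x²` and `y`, so it is removed by a shear of the target; the odd part `x b (x², y)` is
straightened by taking `b` as new coordinate on the source, and correspondingly on the target. -/
theorem IsWhitneyPoint.germEquiv_of_sq [FiniteDimensional ℝ Y] {d : ℝ × Y → Y} (hd : ContDiff ℝ ∞ d)
    (h : IsWhitneyPoint (fun u : ℝ × Y => (u.2, (u.1 ^ 2, d u))) 0) :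
    GermEquiv (fun u : ℝ × Y => (u.2, (u.1 ^ 2, d u))) 0 (whitneyUmbrella : ℝ × Y → _) 0 := by
  obtain ⟨a, b, ha, hb, hab⟩ := exists_contDiff_even_add_odd_smul hd
  have hG : ContDiff ℝ ∞ fun u : ℝ × Y => (u.2, (u.1 ^ 2, d u)) := by fun_prop
  have hβ : ContDiff ℝ ∞ fun u : ℝ × Y => b (u.1 ^ 2, u.2) := by fun_prop
  have hG' : ContDiff ℝ ∞ fun u : ℝ × Y => (u.2, (u.1 ^ 2, u.1 • b (u.1 ^ 2, u.2))) := by fun_prop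
  have e1 : GermEquiv (fun u : ℝ × Y => (u.2, (u.1 ^ 2, d u))) 0
      (fun u : ℝ × Y => (u.2, (u.1 ^ 2, u.1 • b (u.1 ^ 2, u.2)))) 0 := by
    refine GermEquiv.of_injective rfl rfl (a := id)
      (b := fun w => (w.1, (w.2.1, w.2.2 - a (w.2.1, w.1)))) hG.continuous.continuousAt
      (contDiff_id.smoothNear _) (by simp) rfl ?_ ?_ ?_
    · exact ContDiff.smoothNear (by fun_prop) _
    · intro v hv
      set q : Y × (ℝ × Y) := ((0 : ℝ × Y).2, ((0 : ℝ × Y).1 ^ 2, d 0)) with hq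
      have h1 : HasFDerivAt (fun w : Y × (ℝ × Y) => (w.2.1, w.1)) _ q :=
        (hasFDerivAt_snd (𝕜 := ℝ) (p := q)).fst.prodMk (hasFDerivAt_fst (𝕜 := ℝ) (p := q))
      have h2 := (hasFDerivAt_fst (𝕜 := ℝ) (p := q)).prodMk
        ((hasFDerivAt_snd (𝕜 := ℝ) (p := q)).fst.prodMk
          ((hasFDerivAt_snd (𝕜 := ℝ) (p := q)).snd.sub
            ((ha.differentiable (by simp) (q.2.1, q.1)).hasFDerivAt.comp q h1)))
      erw [h2.fderiv] at hv
      obtain ⟨v1, v2, v3⟩ := v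
      simp at hv
      obtain ⟨rfl, rfl, h3⟩ := hv
      simpa [Prod.mk_zero_zero] using h3
    · filter_upwards [hab] with u hu
      simp [hu]
  have h5 := h.of_germEquiv e1 hG.contDiffAt hG'.contDiffAt
  have hβd : ∀ v : ℝ × Y, fderiv ℝ (fun u : ℝ × Y => b (u.1 ^ 2, u.2)) 0 v =
      fderiv ℝ b 0 (0, v.2) := fun v => by
    have h1 : HasFDerivAt (fun u : ℝ × Y => (u.1 ^ 2, u.2)) _ 0 :=
      ((hasFDerivAt_fst (𝕜 := ℝ) (p := (0 : ℝ × Y))).pow 2).prodMk hasFDerivAt_snd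
    have h2 := (hb.differentiable (by simp) ((0 : ℝ × Y).1 ^ 2, (0 : ℝ × Y).2)).hasFDerivAt.comp
      (0 : ℝ × Y) h1
    erw [h2.fderiv]
    simp [Prod.mk_zero_zero]
  obtain ⟨hb0, hbs⟩ := (isWhitneyPoint_iff_of_odd hβ (by simp [hβd, Prod.mk_zero_zero])).1 h5
  have hb0' : b 0 = 0 := by simpa [Prod.mk_zero_zero] using hb0
  have hbi : ∀ y, fderiv ℝ b 0 (0, y) = 0 → y = 0 := by
    have hlin : Function.Surjective ((fderiv ℝ b 0).comp (ContinuousLinearMap.inr ℝ ℝ Y)) :=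
      fun w => by
        obtain ⟨y, hy⟩ := hbs w
        exact ⟨y, by simpa [hβd] using hy⟩
    have := (LinearMap.injective_iff_surjective (f :=
      ((fderiv ℝ b 0).comp (ContinuousLinearMap.inr ℝ ℝ Y)).toLinearMap)).2 hlin
    intro y hy
    exact this (by simpa [Prod.mk_zero_zero] using hy)
  refine e1.trans (GermEquiv.of_injective rfl rfl (a := fun u => (u.1, b (u.1 ^ 2, u.2)))
      (b := fun w => (b (w.2.1, w.1), w.2)) hG'.continuous.continuousAt ?_ ?_ ?_ ?_ ?_ ?_)
  · exact ContDiff.smoothNear (by fun_prop) _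
  · intro v hv
    have h1 := (hasFDerivAt_fst (𝕜 := ℝ) (p := (0 : ℝ × Y))).prodMk
      (hβ.differentiable (by simp) 0).hasFDerivAt
    rw [h1.fderiv] at hv
    simp [hβd] at hv
    exact Prod.ext hv.1 (hbi _ hv.2)
  · ext
    · simp
    · simp [hb0', Prod.mk_zero_zero]
  · exact ContDiff.smoothNear (by fun_prop) _
  · intro v hv
    simp only [Prod.snd_zero, Prod.fst_zero, ne_eq, OfNat.ofNat_ne_zero, not_false_eq_true, zero_pow,
      zero_smul] at hv
    have h1 : HasFDerivAt (fun w : Y × (ℝ × Y) => (w.2.1, w.1)) _ 0 :=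
      (hasFDerivAt_snd (𝕜 := ℝ) (p := (0 : Y × (ℝ × Y)))).fst.prodMk (hasFDerivAt_fst (𝕜 := ℝ))
    have h2 := (((hb.differentiable (by simp) ((0 : Y × (ℝ × Y)).2.1, (0 : Y × (ℝ × Y)).1)).hasFDerivAt.comp
      (0 : Y × (ℝ × Y)) h1)).prodMk
      (hasFDerivAt_snd (𝕜 := ℝ) (p := (0 : Y × (ℝ × Y))))
    erw [h2.fderiv] at hv
    obtain ⟨v1, v2, v3⟩ := v
    simp at hv
    obtain ⟨h3, rfl, rfl⟩ := hv
    simpa using hbi _ h3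
  · exact Eventually.of_forall fun u => rfl

end NormalForm

/-! ### Normal form at a Whitney point -/

section NormalForm

variable {Y : Type} [NormedAddCommGroup Y] [InnerProductSpace ℝ Y] [FiniteDimensional ℝ Y]

/-- The Morse lemma in one variable with parameters: a function `c (x, y)` whose restriction to the
first axis has a nondegenerate minimum at the origin is `c₀ y + X (x, y) ^ 2` with `X` a new first
coordinate. -/
theorem exists_eq_add_sq {c : ℝ × Y → ℝ} (hc : ContDiff ℝ ∞ c) (h0 : fderiv ℝ c 0 (1, 0) = 0)
    (h1 : fderiv ℝ (fun u => fderiv ℝ c u (1, 0)) 0 (1, 0) = 2) :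
    ∃ (c₀ : Y → ℝ) (X : ℝ × Y → ℝ), ContDiff ℝ ∞ c₀ ∧ SmoothNear X 0 ∧ X 0 = 0 ∧
      fderiv ℝ X 0 (1, 0) = 1 ∧ ∀ᶠ u in 𝓝 (0 : ℝ × Y), c u = c₀ u.2 + X u ^ 2 := by
  set p : ℝ × Y → ℝ := fun u => fderiv ℝ c u (1, 0) with hp
  have hps : ContDiff ℝ ∞ p := (hc.fderiv_right (by simp)).clm_apply contDiff_const
  -- The critical points of `c (·, y)` near the origin form the graph of a smooth function `ξ`.
  obtain ⟨ξ, hξ, hξ0, hξp⟩ : ∃ ξ : Y → ℝ, ContDiff ℝ ∞ ξ ∧ ξ 0 = 0 ∧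
      ∀ᶠ y in 𝓝 (0 : Y), p (ξ y, y) = 0 := by
    have hβ : ContDiff ℝ ∞ fun u : ℝ × Y => (p u, u.2) := hps.prodMk contDiff_snd
    have hβd : ∀ v, fderiv ℝ (fun u : ℝ × Y => (p u, u.2)) 0 v = 0 → v = 0 := fun v hv => by
      have h2 := (hps.differentiable (by simp) 0).hasFDerivAt.prodMk
        (hasFDerivAt_snd (𝕜 := ℝ) (p := (0 : ℝ × Y)))
      rw [h2.fderiv] at hv
      simp only [ContinuousLinearMap.prod_apply, ContinuousLinearMap.coe_snd', Prod.mk_eq_zero] at hv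
      obtain ⟨hv1, hv2⟩ := hv
      have h3 : v = v.1 • (1, 0) := by ext <;> simp [hv2]
      rw [h3, map_smul, h1] at hv1
      exact Prod.ext (by simpa using hv1) hv2
    obtain ⟨A, hA⟩ := ContinuousLinearMap.exists_equiv_of_injective _ hβd rfl
    obtain ⟨e, he, he0, hee⟩ := (hβ.smoothNear 0).exists_isSmoothCoordinates (A := A)
      (hA ▸ (hβ.differentiable (by simp) 0).hasFDerivAt)
    have he00 : e 0 = 0 := by rw [hee]; exact Prod.ext h0 rfl
    have ht : ((0 : ℝ), (0 : Y)) ∈ e.target := by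
      have := e.map_source he0
      rwa [he00] at this
    have hs : SmoothNear (fun y : Y => (e.symm (0, y)).1) 0 := by
      have h5 : SmoothNear (fun w => (e.symm w).1) ((0 : ℝ), (0 : Y)) :=
        SmoothNear.comp (contDiff_fst.smoothNear _) (he.symm.smoothNear ht)
      exact SmoothNear.comp (f := fun y : Y => ((0 : ℝ), y)) h5
        ((contDiff_const.prodMk contDiff_id).smoothNear 0)
    obtain ⟨ξ, hξ, hξe⟩ := hs.exists_contDiff
    refine ⟨ξ, hξ, ?_, ?_⟩
    · have h6 : e.symm (0, 0) = 0 := by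
        have := e.left_inv he0
        rwa [he00] at this
      rw [hξe.eq_of_nhds, h6]
      rfl
    · have hc : ContinuousAt (fun y : Y => ((0 : ℝ), y)) 0 := by fun_prop
      filter_upwards [hξe, hc.eventually (e.open_target.mem_nhds ht)] with y hy hyt
      have h7 := e.right_inv hyt
      rw [hee] at h7
      have h8 : (e.symm (0, y)).2 = y := congrArg Prod.snd h7
      have h9 : p (e.symm (0, y)) = 0 := congrArg Prod.fst h7
      rwa [hy, show ((e.symm (0, y)).1, y) = e.symm (0, y) from Prod.ext rfl h8.symm]
  have hpc : ∀ u : ℝ × Y, HasDerivAt (fun x : ℝ => c (x, u.2)) (p u) u.1 := fun u => by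
    have h2 : HasDerivAt (fun x : ℝ => (x, u.2)) ((1 : ℝ), (0 : Y)) u.1 :=
      (hasDerivAt_id u.1).prodMk (hasDerivAt_const u.1 u.2)
    exact ((hc.differentiable (by simp) u).hasFDerivAt).comp_hasDerivAt u.1 h2
  have hc' : ContDiff ℝ ∞ fun u : ℝ × Y => c (u.1 + ξ u.2, u.2) := by fun_prop
  -- Hadamard's lemma, twice, at the critical point: `c (x + ξ y, y) = c (ξ y, y) + x² w (x, y)`.
  obtain ⟨c₁, hc₁, hcc₁⟩ := exists_contDiff_eq_add_smul hc'
  obtain ⟨w, hw, hc₁w⟩ := exists_contDiff_eq_add_smul hc₁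
  simp only [smul_eq_mul, zero_add] at hcc₁ hc₁w
  have hc₁p : ∀ y, c₁ (0, y) = p (ξ y, y) := fun y => by
    have h2 := ((hpc (0 + ξ y, y))).comp_add_const 0 (ξ y)
    have h3 : HasDerivAt (fun x : ℝ => c₁ (x, y)) (fderiv ℝ c₁ (0, y) (1, 0)) 0 :=
      ((hc₁.differentiable (by simp) (0, y)).hasFDerivAt).comp_hasDerivAt (0 : ℝ)
        ((hasDerivAt_id (0 : ℝ)).prodMk (hasDerivAt_const (0 : ℝ) y))
    have h4 := ((hasDerivAt_id (0 : ℝ)).mul h3).const_add (c (ξ y, y))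
    have h5 : (fun x : ℝ => c (x + ξ y, y)) =
        fun x => c (ξ y, y) + ((id : ℝ → ℝ) * fun x : ℝ => c₁ (x, y)) x := funext fun x => hcc₁ (x, y)
    simp only at h2
    rw [h5] at h2
    simpa using (h2.unique h4).symm
  -- On the first axis, `c (x, 0) = c 0 + x² w (x, 0)`, so that `w 0 = 1`.
  have hw0 : w 0 = 1 := by
    have hws : ContDiff ℝ ∞ fun x : ℝ => w (x, 0) := by fun_prop
    have h2 : ∀ x : ℝ, HasDerivAt (fun x : ℝ => w (x, 0)) (deriv (fun x : ℝ => w (x, 0)) x) x :=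
      fun x => (hws.differentiable (by simp) x).hasDerivAt
    have h3 : (fun x : ℝ => c (x, 0)) = fun x => c (0, 0) + x ^ 2 * w (x, 0) := funext fun x => by
      have h4 := hcc₁ (x, 0)
      rw [hc₁w (x, 0), hc₁p] at h4
      simp only [hξ0, add_zero] at h4
      rw [h4, show p (0, 0) = 0 from h0]
      ring
    have h5 : ∀ x : ℝ, p (x, 0) = x * (2 * w (x, 0) + x * deriv (fun x : ℝ => w (x, 0)) x) :=
      fun x => by
        have h6 := hpc (x, 0)
        simp only at h6
        rw [h3] at h6
        rw [h6.unique (((hasDerivAt_pow 2 x).mul (h2 x)).const_add _)]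
        push_cast
        ring
    have h7 : HasDerivAt (fun x : ℝ => p (x, 0)) 2 0 := by
      have := ((hps.differentiable (by simp) ((0 : ℝ), (0 : Y))).hasFDerivAt).comp_hasDerivAt (0 : ℝ)
        ((hasDerivAt_id (0 : ℝ)).prodMk (hasDerivAt_const (0 : ℝ) (0 : Y)))
      rw [← h1]
      exact this
    have h8 : DifferentiableAt ℝ
        (fun x : ℝ => 2 * w (x, 0) + x * deriv (fun x : ℝ => w (x, 0)) x) 0 := by
      have : ContDiff ℝ 1 (deriv fun x : ℝ => w (x, 0)) :=
        (contDiff_infty_iff_deriv.1 hws).2.of_le (by exact_mod_cast le_top)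
      exact ((hws.differentiable (by simp) 0).const_mul 2).add
        (differentiableAt_id.mul (this.differentiable one_ne_zero 0))
    have h9 := (hasDerivAt_id (0 : ℝ)).mul h8.hasDerivAt
    have h10 := h7.congr_of_eventuallyEq (f₁ := id * _)
      (Eventually.of_forall fun x => (h5 x).symm)
    have h11 := h10.unique h9
    simp only [id, one_mul, zero_mul, add_zero] at h11
    change w (0, 0) = 1
    linarith
  set T : ℝ × Y → ℝ × Y := fun u => (u.1 - ξ u.2, u.2) with hT
  have hTs : ContDiff ℝ ∞ T := by fun_prop
  have hT0 : T 0 = 0 := by ext <;> simp [hT, hξ0]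
  have hwT : ContDiff ℝ ∞ fun u => w (T u) := hw.comp hTs
  have hwpos : ∀ᶠ u in 𝓝 (0 : ℝ × Y), 0 < w (T u) := by
    refine hwT.continuous.continuousAt.eventually (lt_mem_nhds ?_)
    simp only [hT0, hw0]
    exact one_pos
  refine ⟨fun y => c (ξ y, y), fun u => (T u).1 * √(w (T u)), by fun_prop, ?_, by simp [hT0], ?_, ?_⟩
  · filter_upwards [hwpos] with u hu
    exact hTs.fst.contDiffAt.mul (hwT.contDiffAt.sqrt hu.ne')
  · have h2 : DifferentiableAt ℝ (fun u => (T u).1 * √(w (T u))) 0 :=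
      (hTs.fst.contDiffAt.mul (hwT.contDiffAt.sqrt hwpos.self_of_nhds.ne')).differentiableAt
        (n := ∞) (by simp)
    have h3 := h2.hasFDerivAt.comp_hasDerivAt_of_eq (0 : ℝ)
        ((hasDerivAt_id (0 : ℝ)).prodMk (hasDerivAt_const (0 : ℝ) (0 : Y))) (by rfl)
    have hws : ContDiffAt ℝ ∞ (fun x : ℝ => √(w (x, 0))) 0 :=
      (by fun_prop : ContDiff ℝ ∞ fun x : ℝ => w (x, 0)).contDiffAt.sqrt
        (by rw [show w (0, 0) = 1 from hw0]; exact one_ne_zero)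
    have h4 := (hasDerivAt_id (0 : ℝ)).mul (hws.differentiableAt (by simp)).hasDerivAt
    have h5 := (h3.congr_of_eventuallyEq (f₁ := id * fun x : ℝ => √(w (x, 0)))
      (Eventually.of_forall fun x => by simp [hT, hξ0])).unique h4
    rw [h5]
    simp [show w (0, 0) = 1 from hw0]
  · have h2 : Tendsto (fun u : ℝ × Y => u.2) (𝓝 0) (𝓝 0) := continuous_snd.tendsto 0
    filter_upwards [hwpos, h2.eventually hξp] with u hu hu'
    have h3 := hcc₁ (T u)
    rw [hc₁w, hc₁p] at h3
    simp only [hT, sub_add_cancel, hu', zero_add] at h3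
    rw [mul_pow, Real.sq_sqrt hu.le, h3]
    ring

/-- A Whitney point of a map `(x, y) ↦ (y, c (x, y), d (x, y))`, where `c` has a nondegenerate
minimum along the first axis, is a cross-cap. -/
theorem IsWhitneyPoint.germEquiv_of_morse {c : ℝ × Y → ℝ} {d : ℝ × Y → Y} (hc : ContDiff ℝ ∞ c)
    (hd : ContDiff ℝ ∞ d) (h0 : fderiv ℝ c 0 (1, 0) = 0)
    (h1 : fderiv ℝ (fun u => fderiv ℝ c u (1, 0)) 0 (1, 0) = 2)
    (h : IsWhitneyPoint (fun u : ℝ × Y => (u.2, (c u, d u))) 0) :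
    GermEquiv (fun u : ℝ × Y => (u.2, (c u, d u))) 0 (whitneyUmbrella : ℝ × Y → _) 0 := by
  obtain ⟨c₀, X, hc₀, hX, hX0, hXd, hcX⟩ := exists_eq_add_sq hc h0 h1
  have ha : SmoothNear (fun u => (X u, u.2)) 0 := by
    filter_upwards [hX] with u hu using hu.prodMk contDiffAt_snd
  have had : ∀ v, fderiv ℝ (fun u : ℝ × Y => (X u, u.2)) 0 v = 0 → v = 0 := fun v hv => by
    have h2 := (hX.contDiffAt.differentiableAt (by simp)).hasFDerivAt.prodMk
      (hasFDerivAt_snd (𝕜 := ℝ) (p := (0 : ℝ × Y)))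
    rw [h2.fderiv] at hv
    simp only [ContinuousLinearMap.prod_apply, ContinuousLinearMap.coe_snd', Prod.mk_eq_zero] at hv
    obtain ⟨hv1, hv2⟩ := hv
    have h3 : v = v.1 • (1, 0) := by ext <;> simp [hv2]
    rw [h3, map_smul, hXd] at hv1
    exact Prod.ext (by simpa using hv1) hv2
  obtain ⟨A, hA⟩ := ContinuousLinearMap.exists_equiv_of_injective _ had rfl
  obtain ⟨φ, hφ, hφ0, hφa⟩ := ha.exists_isSmoothCoordinates (A := A)
    (hA ▸ (ha.contDiffAt.differentiableAt (by simp)).hasFDerivAt)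
  obtain ⟨d', hd', hdd'⟩ := hφ.exists_contDiff_comp hφ0 (hd.smoothNear 0)
  have hG : ContDiff ℝ ∞ fun u : ℝ × Y => (u.2, (c u, d u)) := by fun_prop
  have hG' : ContDiff ℝ ∞ fun u : ℝ × Y => (u.2, (u.1 ^ 2, d' u)) := by fun_prop
  have e1 : GermEquiv (fun u : ℝ × Y => (u.2, (c u, d u))) 0
      (fun u : ℝ × Y => (u.2, (u.1 ^ 2, d' u))) 0 := by
    refine GermEquiv.of_injective rfl rfl (a := fun u : ℝ × Y => (X u, u.2))
      (b := fun w => (w.1, (w.2.1 - c₀ w.1, w.2.2))) hG.continuous.continuousAt ha had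
      (Prod.ext hX0 rfl) ?_ ?_ ?_
    · exact ContDiff.smoothNear (by fun_prop) _
    · intro v hv
      set q : Y × (ℝ × Y) := ((0 : ℝ × Y).2, (c 0, d 0)) with hq
      have h2 := (hasFDerivAt_fst (𝕜 := ℝ) (p := q)).prodMk
        (((hasFDerivAt_snd (𝕜 := ℝ) (p := q)).fst.sub
          ((hc₀.differentiable (by simp) q.1).hasFDerivAt.comp q
            (hasFDerivAt_fst (𝕜 := ℝ) (p := q)))).prodMk (hasFDerivAt_snd (𝕜 := ℝ) (p := q)).snd)
      erw [h2.fderiv] at hv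
      obtain ⟨v1, v2, v3⟩ := v
      simp at hv
      obtain ⟨rfl, h3, rfl⟩ := hv
      simpa [Prod.mk_zero_zero] using h3
    · filter_upwards [hdd', hcX] with u hu hu'
      rw [hφa] at hu
      simp [hu, hu']
  exact e1.trans ((h.of_germEquiv e1 hG.contDiffAt hG'.contDiffAt).germEquiv_of_sq hd')

/-- A Whitney point of a map `(x, y) ↦ (y, Q (x, y))` with `dQ (0) = 0` is a cross-cap. -/
theorem IsWhitneyPoint.germEquiv_of_graph {Q : ℝ × Y → ℝ × Y} (hQ : ContDiff ℝ ∞ Q)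
    (h0 : fderiv ℝ Q 0 = 0) (h : IsWhitneyPoint (fun u : ℝ × Y => (u.2, Q u)) 0) :
    GermEquiv (fun u : ℝ × Y => (u.2, Q u)) 0 (whitneyUmbrella : ℝ × Y → _) 0 := by
  have hG : ContDiff ℝ ∞ fun u : ℝ × Y => (u.2, Q u) := by fun_prop
  -- The second derivative in the direction of the kernel is an isomorphism onto the cokernel.
  have hsurj : ∀ w, ∃ v, fderiv ℝ (fderiv ℝ Q) 0 v (1, 0) = w := fun w => by
    obtain ⟨k, hk0, hk, hs⟩ := h
    have h1 : ∀ v, fderiv ℝ (fun u : ℝ × Y => (u.2, Q u)) 0 v = (v.2, 0) := fun v => by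
      have h2 := (hasFDerivAt_snd (𝕜 := ℝ) (p := (0 : ℝ × Y))).prodMk
        (hQ.differentiable (by simp) 0).hasFDerivAt
      rw [h2.fderiv, h0]
      simp
    have h2 : ∀ v, (fderiv ℝ (fderiv ℝ fun u : ℝ × Y => (u.2, Q u)) 0 v k).2 =
        fderiv ℝ (fderiv ℝ Q) 0 v k := fun v => by
      have h3 := fderiv_fderiv_comp (a := (ContinuousLinearMap.snd ℝ Y (ℝ × Y)))
        (ContinuousLinearMap.contDiff _).contDiffAt (hG.contDiffAt (x := 0)) v k
      have h4 : fderiv ℝ (ContinuousLinearMap.snd ℝ Y (ℝ × Y)) =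
        fun _ => ContinuousLinearMap.snd ℝ Y (ℝ × Y) := by ext1 q; exact ContinuousLinearMap.fderiv _
      rw [h4] at h3
      simpa using h3.symm
    have hk2 : k.2 = 0 := by
      have := (hk k).2 ⟨1, by simp⟩
      rw [h1] at this
      exact congrArg Prod.fst this
    have hk' : k = k.1 • (1, 0) := by ext <;> simp [hk2]
    obtain ⟨v, u, hvu⟩ := hs (0, w)
    refine ⟨k.1 • v, ?_⟩
    have h3 := congrArg Prod.snd hvu
    rw [Prod.snd_add, h2, h1, hk', map_smul] at h3
    simpa using h3
  have hinj : ∀ v, fderiv ℝ (fderiv ℝ Q) 0 v (1, 0) = 0 → v = 0 := by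
    have := (LinearMap.injective_iff_surjective
      (f := ((fderiv ℝ (fderiv ℝ Q) 0).flip (1, 0)).toLinearMap)).2 hsurj
    exact fun v hv => this (by simpa using hv)
  -- A linear change of the target normalizes the second derivative along the kernel to `(2, 0)`.
  obtain ⟨B, hB⟩ := SeparatingDual.exists_continuousLinearEquiv_apply_eq (R := ℝ)
    (x := fderiv ℝ (fderiv ℝ Q) 0 (1, 0) (1, 0)) (y := ((2 : ℝ), (0 : Y)))
    (fun h => by simpa using hinj _ h) (by simp)
  have hc : ContDiff ℝ ∞ fun u => (B (Q u)).1 := by fun_prop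
  have hd : ContDiff ℝ ∞ fun u => (B (Q u)).2 := by fun_prop
  have hcd : ∀ u v, fderiv ℝ (fun u => (B (Q u)).1) u v = (B (fderiv ℝ Q u v)).1 := fun u v => by
    have := ((B : (ℝ × Y) →L[ℝ] (ℝ × Y)).hasFDerivAt.comp u
      (hQ.differentiable (by simp) u).hasFDerivAt).fst
    erw [this.fderiv]
    simp
  have e1 : GermEquiv (fun u : ℝ × Y => (u.2, Q u)) 0
      (fun u : ℝ × Y => (u.2, ((B (Q u)).1, (B (Q u)).2))) 0 := by
    refine GermEquiv.of_hasFDerivAt (A := ContinuousLinearEquiv.refl ℝ _)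
      (B := (ContinuousLinearEquiv.refl ℝ Y).prodCongr B) (a := id)
      hG.continuous.continuousAt (contDiff_id.smoothNear _) (hasFDerivAt_id _) rfl
      ((ContinuousLinearEquiv.contDiff _).smoothNear _) (ContinuousLinearEquiv.hasFDerivAt _)
      (Eventually.of_forall fun u => rfl)
  refine e1.trans ((h.of_germEquiv e1 hG.contDiffAt ?_).germEquiv_of_morse hc hd ?_ ?_)
  · exact ContDiff.contDiffAt (by fun_prop)
  · rw [hcd, h0]
    simp
  · simp_rw [hcd]
    have hD := ((hQ.fderiv_right (m := 1) (by norm_cast)).differentiable one_ne_zero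
      0).hasFDerivAt.clm_apply (hasFDerivAt_const ((1, 0) : ℝ × Y) 0)
    have := ((B : (ℝ × Y) →L[ℝ] (ℝ × Y)).hasFDerivAt.comp (0 : ℝ × Y) hD).fst
    erw [this.fderiv]
    simp [hB]

/-- Whitney's normal form: a Whitney point of a map from an `m`-dimensional space to a
`(2m - 1)`-dimensional space is a cross-cap. -/
theorem IsWhitneyPoint.germEquiv {E F : Type*} [NormedAddCommGroup E] [NormedSpace ℝ E]
    [FiniteDimensional ℝ E] [NormedAddCommGroup F] [NormedSpace ℝ F] [FiniteDimensional ℝ F]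
    (hE : Module.finrank ℝ E = Module.finrank ℝ Y + 1)
    (hF : Module.finrank ℝ F = 2 * Module.finrank ℝ Y + 1) {g : E → F} {x : E}
    (hg : SmoothNear g x) (h : IsWhitneyPoint g x) :
    GermEquiv g x (whitneyUmbrella : ℝ × Y → _) 0 := by
  obtain ⟨k, hk0, hk, -⟩ := id h
  set R := LinearMap.range (fderiv ℝ g x).toLinearMap with hR
  have hker : LinearMap.ker (fderiv ℝ g x).toLinearMap = Submodule.span ℝ {k} := by
    ext v
    rw [LinearMap.mem_ker, Submodule.mem_span_singleton]
    exact (hk v).trans (exists_congr fun c => eq_comm)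
  have hfR : Module.finrank ℝ R = Module.finrank ℝ Y := by
    have := LinearMap.finrank_range_add_finrank_ker (fderiv ℝ g x).toLinearMap
    rw [hker, finrank_span_singleton hk0, hE] at this
    exact Nat.add_right_cancel this
  obtain ⟨R', hRR'⟩ := Submodule.exists_isCompl R
  have hfR' : Module.finrank ℝ R' = Module.finrank ℝ (ℝ × Y) := by
    have := Submodule.finrank_add_eq_of_isCompl hRR'
    rw [Module.finrank_prod, Module.finrank_self]
    omega
  -- `L` splits the target into the range of the differential and a complement.
  let L : F ≃L[ℝ] Y × (ℝ × Y) := ((Submodule.prodEquivOfIsCompl R R' hRR').symm ≪≫ₗ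
    (LinearEquiv.ofFinrankEq R Y hfR).prodCongr
      (LinearEquiv.ofFinrankEq R' (ℝ × Y) hfR')).toContinuousLinearEquiv
  have hL : ∀ v, (L (fderiv ℝ g x v)).2 = 0 := fun v => by
    have h1 := Submodule.prodEquivOfIsCompl_symm_apply_left R R' hRR' ⟨fderiv ℝ g x v, ⟨v, rfl⟩⟩
    simp only at h1
    simp [L, h1]
  obtain ⟨κ, hκ⟩ := SeparatingDual.exists_eq_one (R := ℝ) hk0
  have hLg : SmoothNear (fun y => L (g y) - L (g x)) x := by
    filter_upwards [hg] with y hy using (L.contDiff.contDiffAt.comp y hy).sub contDiffAt_const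
  have hLgd : HasFDerivAt (fun y => L (g y) - L (g x))
      ((L : F →L[ℝ] Y × (ℝ × Y)).comp (fderiv ℝ g x)) x :=
    ((L : F →L[ℝ] Y × (ℝ × Y)).hasFDerivAt.comp x
      (hg.contDiffAt.differentiableAt (by simp)).hasFDerivAt).sub_const _
  -- The component of `g` along the range, together with a linear form that is `1` on `k`, gives
  -- coordinates on the source, in which `g` becomes a graph.
  set a : E → ℝ × Y := fun y => (κ (y - x), (L (g y) - L (g x)).1) with ha
  have has : SmoothNear a x := by
    filter_upwards [hLg] with y hy
    exact (κ.contDiff.contDiffAt.comp y (contDiffAt_id.sub contDiffAt_const)).prodMk hy.fst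
  have had : HasFDerivAt a _ x :=
    (κ.hasFDerivAt.comp x ((hasFDerivAt_id x).sub_const x)).prodMk hLgd.fst
  have hai : ∀ v, fderiv ℝ a x v = 0 → v = 0 := fun v hv => by
    rw [had.fderiv] at hv
    simp at hv
    have h1 : L (fderiv ℝ g x v) = 0 := Prod.ext hv.2 (hL v)
    obtain ⟨c, rfl⟩ := (hk v).1 (by simpa using h1)
    have : c = 0 := by simpa [hκ] using hv.1
    rw [this, zero_smul]
  have hdim : Module.finrank ℝ E = Module.finrank ℝ (ℝ × Y) := by
    rw [hE, Module.finrank_prod, Module.finrank_self, add_comm]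
  obtain ⟨A, hA⟩ := ContinuousLinearMap.exists_equiv_of_injective _ hai hdim
  have hAd : HasFDerivAt a (A : E →L[ℝ] ℝ × Y) x :=
    hA ▸ (has.contDiffAt.differentiableAt (by simp)).hasFDerivAt
  obtain ⟨φ, hφ, hxφ, hφa⟩ := has.exists_isSmoothCoordinates hAd
  have ha0 : a x = 0 := by simp [ha]
  obtain ⟨Q, hQ, hQg⟩ := hφ.exists_contDiff_comp (g := fun y => (L (g y) - L (g x)).2) hxφ
    (SmoothNear.comp (contDiff_snd.smoothNear _) hLg)
  rw [hφa] at hQg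
  have hQ0 : fderiv ℝ Q 0 = 0 := by
    have h1 := (ha0 ▸ (hQ.differentiable (by simp) 0).hasFDerivAt :
      HasFDerivAt Q (fderiv ℝ Q 0) (a x)).comp x hAd
    have h2 := (h1.congr_of_eventuallyEq (f₁ := fun y => (L (g y) - L (g x)).2)
      (hQg.mono fun y hy => hy.symm)).unique hLgd.snd
    refine ContinuousLinearMap.ext fun v => ?_
    have h3 := DFunLike.congr_fun h2 (A.symm v)
    simpa [hL] using h3
  have hG : ContDiff ℝ ∞ fun u : ℝ × Y => (u.2, Q u) := by fun_prop
  have e1 : GermEquiv g x (fun u : ℝ × Y => (u.2, Q u)) 0 := by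
    refine GermEquiv.of_hasFDerivAt (B := L) (b := fun w => L w - L (g x))
      hg.contDiffAt.continuousAt has hAd ha0 ?_ (L.hasFDerivAt.sub_const _) ?_
    · exact (L.contDiff.sub contDiff_const).smoothNear _
    · filter_upwards [hQg] with y hy
      exact Prod.ext rfl hy.symm
  exact e1.trans ((h.of_germEquiv e1 hg.contDiffAt hG.contDiffAt).germEquiv_of_graph hQ hQ0)

end NormalForm

/-! ### Level sets and matrices of corank one -/

section LevelSets

variable {E G : Type*} [NormedAddCommGroup E] [NormedSpace ℝ E] [FiniteDimensional ℝ E]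
  [NormedAddCommGroup G] [NormedSpace ℝ G]

/-- A regular level set has a smooth coordinate system centred at each of its points. -/
theorem exists_isSubmanifoldChart [FiniteDimensional ℝ G] {m : ℕ} {h : E → G}
    (hh : ContDiff ℝ ∞ h) (p : ↥(h ⁻¹' {0})) (hs : Function.Surjective (fderiv ℝ h p))
    (hdim : Module.finrank ℝ E = m + Module.finrank ℝ G) :
    ∃ φ : OpenPartialHomeomorph ↥(h ⁻¹' {0}) (EuclideanSpace ℝ (Fin m)),
      IsSubmanifoldChart φ ∧ p ∈ φ.source ∧ φ p = 0 := by
  set K := LinearMap.ker (fderiv ℝ h p).toLinearMap with hK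
  have hfK : Module.finrank ℝ K = Module.finrank ℝ (EuclideanSpace ℝ (Fin m)) := by
    have h1 := LinearMap.finrank_range_add_finrank_ker (fderiv ℝ h p).toLinearMap
    rw [LinearMap.range_eq_top.2 hs, finrank_top, hdim, add_comm] at h1
    rw [finrank_euclideanSpace_fin]
    exact Nat.add_right_cancel h1
  obtain ⟨π₀, hπ₀⟩ := LinearMap.exists_extend
    (LinearEquiv.ofFinrankEq K (EuclideanSpace ℝ (Fin m)) hfK).toLinearMap
  -- A linear map that is an isomorphism on `ker dh (p)` completes `h` to a coordinate system of `E`.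
  set π := LinearMap.toContinuousLinearMap π₀ with hπ
  set a : E → G × EuclideanSpace ℝ (Fin m) := fun x => (h x, π (x - p)) with ha
  have has : ContDiff ℝ ∞ a := by fun_prop
  have had : HasFDerivAt a _ (p : E) := ((hh.differentiable (by simp) p).hasFDerivAt).prodMk
    (π.hasFDerivAt.comp (p : E) ((hasFDerivAt_id (p : E)).sub_const (p : E)))
  have hai : ∀ v, fderiv ℝ a p v = 0 → v = 0 := fun v hv => by
    rw [had.fderiv] at hv
    simp only [ContinuousLinearMap.prod_apply, Prod.mk_eq_zero, ContinuousLinearMap.comp_apply,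
      ContinuousLinearMap.id_apply] at hv
    have h1 := DFunLike.congr_fun hπ₀ ⟨v, hv.1⟩
    have h2 : π₀ v = 0 := hv.2
    simp only [LinearMap.comp_apply, Submodule.subtype_apply, h2] at h1
    have h3 := (LinearEquiv.map_eq_zero_iff _).1 h1.symm
    exact congrArg Subtype.val h3
  obtain ⟨A, hA⟩ := ContinuousLinearMap.exists_equiv_of_injective _ hai (by
    rw [hdim, Module.finrank_prod, finrank_euclideanSpace_fin, add_comm])
  obtain ⟨e, he, hpe, hea⟩ := (has.smoothNear (p : E)).exists_isSmoothCoordinates (A := A)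
    (hA ▸ (has.differentiable (by simp) _).hasFDerivAt)
  have hmem : ∀ t, ((0 : G), t) ∈ e.target → e.symm (0, t) ∈ h ⁻¹' {0} := fun t ht => by
    have h1 := e.right_inv ht
    rw [hea] at h1
    exact congrArg Prod.fst h1
  have ha1 : ∀ x : ↥(h ⁻¹' {0}), a x = (0, π (x - p)) := fun x => Prod.ext x.2 rfl
  classical
  let φ : OpenPartialHomeomorph ↥(h ⁻¹' {0}) (EuclideanSpace ℝ (Fin m)) :=
    { toFun := fun x => π (x - p)
      invFun := fun t => if ht : ((0 : G), t) ∈ e.target then ⟨e.symm (0, t), hmem t ht⟩ else p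
      source := {x | (x : E) ∈ e.source}
      target := {t | ((0 : G), t) ∈ e.target}
      map_source' := fun x hx => by
        have h1 := e.map_source hx
        rw [hea, ha1] at h1
        exact h1
      map_target' := fun t ht => by
        rw [dif_pos (show ((0 : G), t) ∈ e.target from ht)]
        exact e.map_target ht
      left_inv' := fun x hx => by
        have h1 := e.map_source hx
        have h2 := e.left_inv hx
        rw [hea, ha1] at h1 h2
        rw [dif_pos h1]
        exact Subtype.ext h2
      right_inv' := fun t ht => by
        have h1 := e.right_inv ht
        rw [hea] at h1
        rw [dif_pos (show ((0 : G), t) ∈ e.target from ht)]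
        exact congrArg Prod.snd h1
      open_source := e.open_source.preimage continuous_subtype_val
      open_target := e.open_target.preimage (by fun_prop)
      continuousOn_toFun := by fun_prop
      continuousOn_invFun := by
        rw [Topology.IsEmbedding.subtypeVal.continuousOn_iff]
        refine (e.continuousOn_symm.comp (f := fun t : EuclideanSpace ℝ (Fin m) => ((0 : G), t))
          (by fun_prop) (fun t ht => ht)).congr fun t ht => ?_
        simp only [Function.comp_apply]
        rw [dif_pos (show ((0 : G), t) ∈ e.target from ht)] }
  have hφ : ∀ t ∈ φ.target, (φ.symm t : E) = e.symm (0, t) := fun t ht => by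
    have ht' : ((0 : G), t) ∈ e.target := ht
    change ((if ht : ((0 : G), t) ∈ e.target then ⟨e.symm (0, t), hmem t ht⟩ else p :
      ↥(h ⁻¹' {0})) : E) = _
    rw [dif_pos ht']
  refine ⟨φ, ⟨?_, fun t ht => ?_⟩, hpe, ?_⟩
  · exact (he.2.comp (contDiff_const.prodMk contDiff_id).contDiffOn (fun t ht => ht)).congr hφ
  · obtain ⟨B, hB⟩ := he.symm.exists_hasFDerivAt (x := ((0 : G), t)) ht
    have h1 := hB.comp t ((hasFDerivAt_const (0 : G) t).prodMk (hasFDerivAt_id t))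
    have h2 := h1.congr_of_eventuallyEq (f₁ := fun t => (φ.symm t : E)) (by
      filter_upwards [φ.open_target.mem_nhds ht] with s hs using hφ s hs)
    rw [h2.fderiv]
    intro v w hvw
    have h3 := B.injective hvw
    exact congrArg Prod.snd h3
  · change π ((p : E) - p) = 0
    rw [sub_self, map_zero]

/-- The image of the differential of a parametrization of a regular level set of `h` is the kernel of
the differential of `h`. -/
theorem fderiv_eq_zero_iff_exists {D : Type*} [NormedAddCommGroup D] [NormedSpace ℝ D]
    [FiniteDimensional ℝ D] {h : E → G} {θ : D → E} {t : D} (hh : DifferentiableAt ℝ h (θ t))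
    (hθ : DifferentiableAt ℝ θ t) (h0 : ∀ᶠ s in 𝓝 t, h (θ s) = 0)
    (hi : Function.Injective (fderiv ℝ θ t)) (hs : Function.Surjective (fderiv ℝ h (θ t)))
    (hdim : Module.finrank ℝ E = Module.finrank ℝ D + Module.finrank ℝ G) (v : E) :
    fderiv ℝ h (θ t) v = 0 ↔ ∃ u, fderiv ℝ θ t u = v := by
  have h1 : (fderiv ℝ h (θ t)).comp (fderiv ℝ θ t) = 0 :=
    ((hh.hasFDerivAt.comp t hθ.hasFDerivAt).congr_of_eventuallyEq (f₁ := fun _ => (0 : G))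
      (h0.mono fun s hs => hs.symm)).unique (hasFDerivAt_const 0 t)
  have h2 : LinearMap.range (fderiv ℝ θ t).toLinearMap ≤
      LinearMap.ker (fderiv ℝ h (θ t)).toLinearMap := by
    rintro _ ⟨u, rfl⟩
    exact DFunLike.congr_fun h1 u
  have h3 := Submodule.eq_of_le_of_finrank_eq h2 (by
    have h4 := LinearMap.finrank_range_add_finrank_ker (fderiv ℝ h (θ t)).toLinearMap
    rw [LinearMap.range_eq_top.2 hs, finrank_top, hdim, add_comm] at h4
    rw [LinearMap.finrank_range_of_inj hi]
    exact (Nat.add_right_cancel h4).symm)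
  exact (SetLike.ext_iff.1 h3 v).symm

theorem submanifoldTangentSpace_preimage_eq_ker [FiniteDimensional ℝ G] {m : ℕ} {h : E → G}
    (hh : ContDiff ℝ ∞ h) (p : ↥(h ⁻¹' {0})) (hs : Function.Surjective (fderiv ℝ h p))
    (hdim : Module.finrank ℝ E = m + Module.finrank ℝ G) :
    submanifoldTangentSpace (h ⁻¹' {0}) (p : E) = LinearMap.ker (fderiv ℝ h p).toLinearMap := by
  refine le_antisymm (Submodule.span_le.2 ?_) fun v hv => Submodule.subset_span ?_
  · rintro v ⟨γ, -, hγ0, hγ, hv⟩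
    have h1 := ((hγ0 ▸ (hh.differentiable (by simp) p).hasFDerivAt :
      HasFDerivAt h (fderiv ℝ h p) (γ 0))).comp_hasDerivAt (0 : ℝ) hv
    exact (h1.congr_of_eventuallyEq (f₁ := fun _ => (0 : G)) (hγ.mono fun t ht => ht.symm)).unique
      (hasDerivAt_const (0 : ℝ) 0)
  · obtain ⟨φ, ⟨hφ, hφi⟩, hpφ, hφp⟩ := exists_isSubmanifoldChart hh p hs hdim
    have h0 : (0 : EuclideanSpace ℝ (Fin m)) ∈ φ.target := hφp ▸ φ.map_source hpφ
    have hp0 : (φ.symm 0 : E) = p := by rw [← hφp, φ.left_inv hpφ]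
    have hθ : ContDiffAt ℝ ∞ (fun t => (φ.symm t : E)) 0 :=
      hφ.contDiffAt (φ.open_target.mem_nhds h0)
    have hθd := hθ.differentiableAt (by simp)
    obtain ⟨u, hu⟩ := (fderiv_eq_zero_iff_exists (θ := fun t => (φ.symm t : E)) (t := 0)
      (hh.differentiable (by simp) _) hθd
      (Eventually.of_forall fun s => (φ.symm s).2) (hφi 0 h0) (by rwa [hp0])
      (by rw [hdim, finrank_euclideanSpace_fin]) v).1 (by rw [hp0]; exact hv)
    have hl : HasDerivAt (fun t : ℝ => t • u) u 0 := by
      simpa using (hasDerivAt_id (0 : ℝ)).smul_const u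
    refine ⟨fun t => φ.symm (t • u), ?_, by simp [hp0], Eventually.of_forall fun t =>
      (φ.symm (t • u)).2, ?_⟩
    · exact ContDiffAt.comp (g := fun t => (φ.symm t : E)) (f := fun t : ℝ => t • u) 0
        (by rwa [zero_smul]) (contDiff_id.smul contDiff_const).contDiffAt
    · rw [← hu]
      exact hθd.hasFDerivAt.comp_hasDerivAt_of_eq (0 : ℝ) hl (by simp)

end LevelSets

section Corank

variable {ι κ : Type*} [Fintype κ]

/-- For real `M`, injectivity is detected by the Gram determinant, a continuous function of `M`. -/
theorem Matrix.det_transpose_mul_self_eq_zero_iff [Fintype ι] [DecidableEq κ] (M : Matrix ι κ ℝ) :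
    (Mᵀ * M).det = 0 ↔ ∃ v ≠ 0, M *ᵥ v = 0 := by
  rw [← Matrix.exists_mulVec_eq_zero_iff]
  refine exists_congr fun v => and_congr_right fun _ => ?_
  exact SetLike.ext_iff.1 (Matrix.ker_mulVecLin_transpose_mul_self M) v

theorem Matrix.rank_add_one_eq_card_iff (M : Matrix ι κ ℝ) :
    M.rank + 1 = Fintype.card κ ↔
      ∃ k ≠ 0, ∀ v, M *ᵥ v = 0 ↔ ∃ c : ℝ, v = c • k := by
  have h1 := LinearMap.finrank_range_add_finrank_ker M.mulVecLin
  rw [Module.finrank_fintype_fun_eq_card] at h1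
  have h2 : M.rank + 1 = Fintype.card κ ↔ Module.finrank ℝ (LinearMap.ker M.mulVecLin) = 1 := by
    rw [Matrix.rank]
    omega
  rw [h2]
  constructor
  · intro h3
    obtain ⟨k, hk0, hk⟩ := finrank_eq_one_iff'.1 h3
    refine ⟨k, fun h => hk0 (Subtype.ext h), fun v => ⟨fun hv => ?_, ?_⟩⟩
    · obtain ⟨c, hc⟩ := hk ⟨v, hv⟩
      exact ⟨c, (congrArg Subtype.val hc).symm⟩
    · rintro ⟨c, rfl⟩
      have h4 : M *ᵥ k.1 = 0 := k.2
      rw [Matrix.mulVec_smul, h4, smul_zero]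
  · rintro ⟨k, hk0, hk⟩
    have h4 : LinearMap.ker M.mulVecLin = Submodule.span ℝ {k} := by
      ext v
      rw [LinearMap.mem_ker, Submodule.mem_span_singleton]
      exact (hk v).trans (exists_congr fun c => eq_comm)
    rw [h4, finrank_span_singleton hk0]

theorem HasDerivAt.tendsto_mul_add_slope_mul [Fintype ι] {γ : ℝ → Matrix ι κ ℝ} {B : Matrix ι κ ℝ}
    (hB : HasDerivAt γ B 0) (C D : Matrix κ κ ℝ) :
    Tendsto (fun t => γ t * C + (t⁻¹ • (γ t - γ 0)) * D) (𝓝[≠] 0) (𝓝 (γ 0 * C + B * D)) := by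
  have h1 : Tendsto γ (𝓝[≠] 0) (𝓝 (γ 0)) := by
    have := hB.continuousAt.tendsto
    exact this.mono_left nhdsWithin_le_nhds
  have h2 : Tendsto (fun t => t⁻¹ • (γ t - γ 0)) (𝓝[≠] 0) (𝓝 B) := by
    have := hasDerivAt_iff_tendsto_slope_zero.1 hB
    simp only [zero_add] at this
    exact this
  have h3 : ∀ (C : Matrix κ κ ℝ) (A : Matrix ι κ ℝ),
      Tendsto (fun M : Matrix ι κ ℝ => M * C) (𝓝 A) (𝓝 (A * C)) := fun C A => by
    have : Continuous fun M : Matrix ι κ ℝ => M * C := by fun_prop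
    exact this.tendsto A
  exact ((h3 C _).comp h1).add ((h3 D _).comp h2)

/-- The velocity of a curve of matrices of corank one maps the kernel into the range: otherwise
scaling the direction of the kernel by `t⁻¹` would turn the curve into a family of matrices of
deficient rank which converges to a matrix of full rank. -/
theorem exists_mulVec_eq_of_hasDerivAt [Fintype ι] {γ : ℝ → Matrix ι κ ℝ} {B : Matrix ι κ ℝ}
    {k q : κ → ℝ} (hq : q ⬝ᵥ k = 1) (hk : ∀ v, γ 0 *ᵥ v = 0 ↔ ∃ c : ℝ, v = c • k)
    (hγ : ∀ᶠ t in 𝓝 (0 : ℝ), (γ t).rank + 1 = Fintype.card κ) (hB : HasDerivAt γ B 0) :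
    ∃ u, γ 0 *ᵥ u = B *ᵥ k := by
  classical
  have hAk : γ 0 *ᵥ k = 0 := (hk k).2 ⟨1, by simp⟩
  by_contra! hBS
  have hlim := hB.tendsto_mul_add_slope_mul (1 - Matrix.vecMulVec k q) (Matrix.vecMulVec k q)
  -- `Γ t` is `γ t` on `ker q`, and maps `k` to `t⁻¹ γ t k`; its limit `N` maps `k` to `B k`.
  set Γ : ℝ → Matrix ι κ ℝ := fun t => γ t * (1 - Matrix.vecMulVec k q) +
    (t⁻¹ • (γ t - γ 0)) * Matrix.vecMulVec k q with hΓ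
  set N : Matrix ι κ ℝ := γ 0 * (1 - Matrix.vecMulVec k q) + B * Matrix.vecMulVec k q with hN
  have hdet : Tendsto (fun M : Matrix ι κ ℝ => (Mᵀ * M).det) (𝓝 N) (𝓝 (Nᵀ * N).det) := by
    have : Continuous fun M : Matrix ι κ ℝ => (Mᵀ * M).det := by fun_prop
    exact this.tendsto N
  have hΓv : ∀ t (v : κ → ℝ), Γ t *ᵥ v =
      γ t *ᵥ (v - (q ⬝ᵥ v) • k + (t⁻¹ * (q ⬝ᵥ v)) • k) := fun t v => by
    rw [hΓ, Matrix.add_mulVec, ← Matrix.mulVec_mulVec, ← Matrix.mulVec_mulVec, Matrix.sub_mulVec,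
      Matrix.one_mulVec, Matrix.vecMulVec_mulVec, op_smul_eq_smul, Matrix.smul_mulVec,
      Matrix.sub_mulVec, Matrix.mulVec_smul (γ 0), hAk, smul_zero, sub_zero, Matrix.mulVec_add,
      Matrix.mulVec_smul (γ t) (t⁻¹ * _), Matrix.mulVec_smul (γ t) (q ⬝ᵥ v), mul_smul]
  have hzero : ∀ᶠ t in 𝓝[≠] (0 : ℝ), ((Γ t)ᵀ * Γ t).det = 0 := by
    filter_upwards [nhdsWithin_le_nhds hγ, self_mem_nhdsWithin] with t ht ht0
    have ht0' : t ≠ 0 := ht0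
    rw [Matrix.det_transpose_mul_self_eq_zero_iff]
    obtain ⟨k', hk'0, hk'⟩ := (Matrix.rank_add_one_eq_card_iff (γ t)).1 ht
    have h1 : γ t *ᵥ k' = 0 := (hk' k').2 ⟨1, by simp⟩
    -- Rescaling the component along `k` of the kernel of `γ t` gives the kernel of `Γ t`.
    refine ⟨k' + ((t - 1) * (q ⬝ᵥ k')) • k, fun h => ?_, ?_⟩
    · have h5 := congrArg (fun v => q ⬝ᵥ v) h
      simp only [dotProduct_add, dotProduct_smul, hq, dotProduct_zero, smul_eq_mul, mul_one] at h5
      have h6 : q ⬝ᵥ k' = 0 := by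
        have : t * (q ⬝ᵥ k') = 0 := by linear_combination h5
        exact (mul_eq_zero.1 this).resolve_left ht0'
      rw [h6, mul_zero, zero_smul, add_zero] at h
      exact hk'0 h
    · rw [hΓv, ← h1]
      congr 1
      simp only [dotProduct_add, dotProduct_smul, hq, smul_eq_mul, mul_one]
      rw [show q ⬝ᵥ k' + (t - 1) * (q ⬝ᵥ k') = t * (q ⬝ᵥ k') by ring, ← mul_assoc,
        inv_mul_cancel₀ ht0', one_mul]
      module
  have hdet0 : (Nᵀ * N).det = 0 :=
    tendsto_nhds_unique (hdet.comp hlim) ((tendsto_const_nhds (x := (0 : ℝ))).congr'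
      (hzero.mono fun t ht => ht.symm))
  obtain ⟨v, hv0, hv⟩ := (Matrix.det_transpose_mul_self_eq_zero_iff N).1 hdet0
  have hv' : γ 0 *ᵥ v + (q ⬝ᵥ v) • B *ᵥ k = 0 := by
    rw [← hv, hN, Matrix.add_mulVec, ← Matrix.mulVec_mulVec, ← Matrix.mulVec_mulVec,
      Matrix.sub_mulVec, Matrix.one_mulVec, Matrix.vecMulVec_mulVec, op_smul_eq_smul,
      Matrix.mulVec_sub, Matrix.mulVec_smul, hAk, smul_zero, sub_zero, Matrix.mulVec_smul]
  by_cases hqv : q ⬝ᵥ v = 0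
  · rw [hqv, zero_smul, add_zero] at hv'
    obtain ⟨c, rfl⟩ := (hk v).1 hv'
    rw [dotProduct_smul, hq, smul_eq_mul, mul_one] at hqv
    exact hv0 (by rw [hqv, zero_smul])
  · refine hBS (-(q ⬝ᵥ v)⁻¹ • v) ?_
    rw [Matrix.mulVec_smul, eq_neg_of_add_eq_zero_left hv', smul_neg, neg_smul, neg_neg, smul_smul,
      inv_mul_cancel₀ hqv, one_smul]

/-- A matrix which maps the kernel `ℝ k` of `A` into the range of `A` is of the form `X A + A Z`. -/
theorem exists_eq_mul_add_mul [Fintype ι] {A B : Matrix ι κ ℝ} {k q u : κ → ℝ} (hq : q ⬝ᵥ k = 1)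
    (hk : ∀ v, A *ᵥ v = 0 ↔ ∃ c : ℝ, v = c • k) (hu : B *ᵥ k = A *ᵥ u) :
    ∃ (X : Matrix ι ι ℝ) (Z : Matrix κ κ ℝ), B = X * A + A * Z := by
  classical
  have hAk : A *ᵥ k = 0 := (hk k).2 ⟨1, by simp⟩
  have hinj : Function.Injective (A.mulVecLin.prod (dotProductBilin ℝ ℝ q)) := by
    rw [injective_iff_map_eq_zero]
    intro v hv
    have h1 : A *ᵥ v = 0 := congrArg Prod.fst hv
    have h2 : q ⬝ᵥ v = 0 := congrArg Prod.snd hv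
    obtain ⟨c, rfl⟩ := (hk v).1 h1
    rw [dotProduct_smul, hq, smul_eq_mul, mul_one] at h2
    rw [h2, zero_smul]
  obtain ⟨J, hJ⟩ := LinearMap.exists_leftInverse_of_injective _ (LinearMap.ker_eq_bot.2 hinj)
  -- `C` vanishes on the kernel of `A`, hence factors as `X A`; here `J` is a left inverse of
  -- `v ↦ (A v, q v)`.
  set C := B - A * Matrix.vecMulVec u q with hC
  have hCk : C *ᵥ k = 0 := by
    rw [hC, Matrix.sub_mulVec, ← Matrix.mulVec_mulVec, Matrix.vecMulVec_mulVec, hq,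
      op_smul_eq_smul, one_smul, hu, sub_self]
  refine ⟨LinearMap.toMatrix' (C.mulVecLin ∘ₗ J ∘ₗ LinearMap.inl ℝ _ _), Matrix.vecMulVec u q, ?_⟩
  rw [← sub_eq_iff_eq_add, ← hC]
  refine Matrix.ext_of_mulVec_single fun j => ?_
  set v : κ → ℝ := Pi.single j 1
  have h1 := DFunLike.congr_fun hJ (v - (q ⬝ᵥ v) • k)
  have h2 : (A.mulVecLin.prod (dotProductBilin ℝ ℝ q)) (v - (q ⬝ᵥ v) • k) = (A *ᵥ v, 0) := by
    refine Prod.ext ?_ ?_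
    · change A *ᵥ (v - (q ⬝ᵥ v) • k) = A *ᵥ v
      rw [Matrix.mulVec_sub, Matrix.mulVec_smul, hAk, smul_zero, sub_zero]
    · change q ⬝ᵥ (v - (q ⬝ᵥ v) • k) = 0
      rw [dotProduct_sub, dotProduct_smul, hq, smul_eq_mul, mul_one, sub_self]
  rw [LinearMap.comp_apply, h2] at h1
  rw [← Matrix.mulVec_mulVec, LinearMap.toMatrix'_mulVec]
  change C *ᵥ v = C *ᵥ (J (A *ᵥ v, 0))
  rw [h1, LinearMap.id_apply, Matrix.mulVec_sub, Matrix.mulVec_smul, hCk, smul_zero, sub_zero]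

/-- The tangent space of the set of matrices of corank one at `A` consists of the matrices which map
the kernel of `A` into its range. -/
theorem mem_submanifoldTangentSpace_corankSet_iff [Fintype ι] {A B : Matrix ι κ ℝ} {k : κ → ℝ}
    (hk0 : k ≠ 0) (hk : ∀ v, A *ᵥ v = 0 ↔ ∃ c : ℝ, v = c • k) :
    B ∈ submanifoldTangentSpace (corankSet ι κ 1) A ↔ ∃ u, B *ᵥ k = A *ᵥ u := by
  classical
  obtain ⟨q, hq⟩ : ∃ q : κ → ℝ, q ⬝ᵥ k = 1 := by
    refine ⟨(k ⬝ᵥ k)⁻¹ • k, ?_⟩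
    rw [smul_dotProduct, smul_eq_mul, inv_mul_cancel₀]
    exact fun h => hk0 (dotProduct_self_eq_zero.1 h)
  constructor
  · intro hB
    let S : Submodule ℝ (Matrix ι κ ℝ) :=
      (LinearMap.range A.mulVecLin).comap ((Matrix.mulVecBilin ℝ ℝ).flip k)
    suffices h : submanifoldTangentSpace (corankSet ι κ 1) A ≤ S by
      obtain ⟨u, hu⟩ := h hB
      exact ⟨u, hu.symm⟩
    refine Submodule.span_le.2 ?_
    rintro B ⟨γ, -, rfl, hγ, hB⟩
    exact exists_mulVec_eq_of_hasDerivAt hq hk hγ hB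
  · rintro ⟨u, hu⟩
    obtain ⟨X, Z, hXZ⟩ := exists_eq_mul_add_mul hq hk hu
    -- The curve `(1 + t X) A (1 + t Z)` has constant rank near `t = 0` and velocity `X A + A Z = B`.
    refine Submodule.subset_span
      ⟨fun t => A + t • (X * A + A * Z) + t ^ 2 • (X * A * Z), ?_, by simp, ?_, ?_⟩
    · exact ((contDiff_const.add (contDiff_id.smul contDiff_const)).add
        ((contDiff_id.pow 2).smul contDiff_const)).contDiffAt
    · have h1 : ∀ᶠ t in 𝓝 (0 : ℝ), (1 + t • X).det ≠ 0 := by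
        have : Continuous fun t : ℝ => (1 + t • X).det := by fun_prop
        exact this.continuousAt.eventually (isOpen_ne.mem_nhds (by simp))
      have h2 : ∀ᶠ t in 𝓝 (0 : ℝ), (1 + t • Z).det ≠ 0 := by
        have : Continuous fun t : ℝ => (1 + t • Z).det := by fun_prop
        exact this.continuousAt.eventually (isOpen_ne.mem_nhds (by simp))
      filter_upwards [h1, h2] with t ht1 ht2
      have h3 : A + t • (X * A + A * Z) + t ^ 2 • (X * A * Z) =
          (1 + t • X) * A * (1 + t • Z) := by
        simp only [Matrix.add_mul, Matrix.mul_add, Matrix.one_mul, Matrix.mul_one, Matrix.smul_mul,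
          Matrix.mul_smul, smul_add, smul_smul, sq]
        abel
      rw [h3]
      change Matrix.rank _ + 1 = _
      rw [Matrix.rank_mul_eq_left_of_isUnit_det _ _ ht2.isUnit,
        Matrix.rank_mul_eq_right_of_isUnit_det _ _ ht1.isUnit]
      exact (Matrix.rank_add_one_eq_card_iff A).2 ⟨k, hk0, hk⟩
    · rw [hXZ]
      have h1 := ((hasDerivAt_const (0 : ℝ) A).add
        ((hasDerivAt_id (0 : ℝ)).smul_const (X * A + A * Z))).add
          ((hasDerivAt_pow 2 (0 : ℝ)).smul_const (X * A * Z))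
      refine h1.congr_deriv ?_
      simp

end Corank

/-! ### Whitney points of restrictions to level sets, and transversality -/

section LevelSets

variable {D E G F : Type*} [NormedAddCommGroup D] [NormedSpace ℝ D] [NormedAddCommGroup E]
  [NormedSpace ℝ E] [NormedAddCommGroup G] [NormedSpace ℝ G] [NormedAddCommGroup F]
  [NormedSpace ℝ F]

/-- In terms of a parametrization `θ` of the level set `h = 0`, being a Whitney point of the
restriction of `f` to the level set is a condition on the 2-jet of the pair `(h, f)`. -/
theorem isWhitneyPoint_comp_iff {h : E → G} {f : E → F} {θ : D → E} {t : D}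
    (hh : ContDiffAt ℝ ∞ h (θ t)) (hf : ContDiffAt ℝ ∞ f (θ t)) (hθ : ContDiffAt ℝ ∞ θ t)
    (h0 : ∀ᶠ s in 𝓝 t, h (θ s) = 0) (hi : Function.Injective (fderiv ℝ θ t))
    (hs : Function.Surjective (fderiv ℝ h (θ t)))
    (hker : ∀ v, fderiv ℝ h (θ t) v = 0 ↔ ∃ u, fderiv ℝ θ t u = v) :
    IsWhitneyPoint (fun s => f (θ s)) t ↔
      ∃ k : E, k ≠ 0 ∧
        (∀ v, (fderiv ℝ h (θ t) v = 0 ∧ fderiv ℝ f (θ t) v = 0) ↔ ∃ c : ℝ, v = c • k) ∧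
        ∀ (w₁ : G) (w₂ : F), ∃ v u : E, fderiv ℝ h (θ t) v = 0 ∧
          fderiv ℝ (fderiv ℝ h) (θ t) v k + fderiv ℝ h (θ t) u = w₁ ∧
          fderiv ℝ (fderiv ℝ f) (θ t) v k + fderiv ℝ f (θ t) u = w₂ := by
  have hD : ∀ v, fderiv ℝ (fun s => f (θ s)) t v = fderiv ℝ f (θ t) (fderiv ℝ θ t v) := fun v =>
    DFunLike.congr_fun (fderiv_comp t (hf.differentiableAt (by simp))
      (hθ.differentiableAt (by simp))) v
  have hD2f := fderiv_fderiv_comp hf hθ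
  have hD2h : ∀ v k, fderiv ℝ (fderiv ℝ h) (θ t) (fderiv ℝ θ t v) (fderiv ℝ θ t k) +
      fderiv ℝ h (θ t) (fderiv ℝ (fderiv ℝ θ) t v k) = 0 := fun v k => by
    rw [← fderiv_fderiv_comp hh hθ]
    have h1 : (fun s => h (θ s)) =ᶠ[𝓝 t] fun _ => (0 : G) := h0
    rw [(h1.fderiv (𝕜 := ℝ)).fderiv_eq]
    simp
  have hker' : ∀ v, fderiv ℝ h (θ t) (fderiv ℝ θ t v) = 0 := fun v => (hker _).2 ⟨v, rfl⟩
  constructor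
  · rintro ⟨k, hk0, hk, hsurj⟩
    refine ⟨fderiv ℝ θ t k, fun h => hk0 (hi (h.trans (map_zero _).symm)), fun v => ?_,
      fun w₁ w₂ => ?_⟩
    · constructor
      · rintro ⟨h1, h2⟩
        obtain ⟨u, rfl⟩ := (hker v).1 h1
        obtain ⟨c, rfl⟩ := (hk u).1 (by rw [hD]; exact h2)
        exact ⟨c, map_smul _ _ _⟩
      · rintro ⟨c, rfl⟩
        have h1 := (hk k).2 ⟨1, by simp⟩
        rw [hD] at h1
        rw [map_smul, map_smul, hker', h1]
        simp
    · obtain ⟨u₁, hu₁⟩ := hs w₁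
      obtain ⟨v, u, hvu⟩ := hsurj (w₂ - fderiv ℝ f (θ t) u₁)
      rw [hD2f, hD] at hvu
      refine ⟨fderiv ℝ θ t v, u₁ + fderiv ℝ (fderiv ℝ θ) t v k + fderiv ℝ θ t u, hker' v, ?_, ?_⟩
      · have h1 := hD2h v k
        simp only [map_add, hker', hu₁, add_zero]
        rw [add_left_comm, h1, add_zero]
      · rw [map_add, map_add, ← eq_sub_iff_add_eq.1 hvu]
        abel
  · rintro ⟨k', hk'0, hk', hsurj⟩
    obtain ⟨k, rfl⟩ := (hker k').1 ((hk' k').2 ⟨1, by simp⟩).1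
    refine ⟨k, fun h => hk'0 (by rw [h, map_zero]), fun v => ?_, fun w => ?_⟩
    · rw [hD]
      have h1 := hk' (fderiv ℝ θ t v)
      simp only [hker', true_and] at h1
      rw [h1]
      refine exists_congr fun c => ?_
      rw [← map_smul]
      exact hi.eq_iff
    · obtain ⟨v', u', hv', h1, h2⟩ := hsurj 0 w
      obtain ⟨v, rfl⟩ := (hker v').1 hv'
      obtain ⟨u, hu⟩ := (hker (u' - fderiv ℝ (fderiv ℝ θ) t v k)).1 (by
        rw [map_sub, sub_eq_zero]
        exact add_left_cancel (h1.trans (hD2h v k).symm))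
      refine ⟨v, u, ?_⟩
      rw [hD2f, hD, hu, map_sub, add_add_sub_cancel]
      exact h2

end LevelSets

section Jacobian

variable {ι κ : Type*} [Fintype ι] [Fintype κ] [DecidableEq κ]

/-- The matrix of a linear map between Euclidean spaces in the standard bases. -/
noncomputable def euclideanToMatrix (ι κ : Type*) [Fintype ι] [Fintype κ] [DecidableEq κ] :
    (EuclideanSpace ℝ κ →L[ℝ] EuclideanSpace ℝ ι) →L[ℝ] Matrix ι κ ℝ :=
  LinearMap.toContinuousLinearMap
    { toFun := fun T => Matrix.of fun i j => T (EuclideanSpace.single j 1) i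
      map_add' := fun _ _ => rfl
      map_smul' := fun _ _ => rfl }

theorem euclideanToMatrix_mulVec (T : EuclideanSpace ℝ κ →L[ℝ] EuclideanSpace ℝ ι) (v : κ → ℝ) :
    euclideanToMatrix ι κ T *ᵥ v = (T (WithLp.toLp 2 v)).ofLp := by
  have h1 : WithLp.toLp 2 v = ∑ j, v j • EuclideanSpace.single j (1 : ℝ) := by
    ext i
    simp [Finset.sum_apply, Pi.single_apply]
  ext i
  rw [h1, map_sum]
  simp only [map_smul, WithLp.ofLp_sum, WithLp.ofLp_smul, Finset.sum_apply, Pi.smul_apply,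
    smul_eq_mul]
  exact Finset.sum_congr rfl fun j _ => mul_comm _ _

theorem jacobianMatrix_mulVec (g : EuclideanSpace ℝ κ → EuclideanSpace ℝ ι)
    (x : EuclideanSpace ℝ κ) (v : κ → ℝ) :
    jacobianMatrix g x *ᵥ v = (fderiv ℝ g x (WithLp.toLp 2 v)).ofLp :=
  euclideanToMatrix_mulVec _ v

theorem fderiv_jacobianMatrix_mulVec {g : EuclideanSpace ℝ κ → EuclideanSpace ℝ ι}
    (hg : ContDiff ℝ ∞ g) (x v : EuclideanSpace ℝ κ) (w : κ → ℝ) :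
    fderiv ℝ (jacobianMatrix g) x v *ᵥ w =
      (fderiv ℝ (fderiv ℝ g) x v (WithLp.toLp 2 w)).ofLp := by
  have h1 : HasFDerivAt (fderiv ℝ g) (fderiv ℝ (fderiv ℝ g) x) x :=
    ((hg.fderiv_right (m := 1) (by norm_cast)).differentiable one_ne_zero x).hasFDerivAt
  have h2 : HasFDerivAt (jacobianMatrix g)
      ((euclideanToMatrix ι κ).comp (fderiv ℝ (fderiv ℝ g) x)) x :=
    (euclideanToMatrix ι κ).hasFDerivAt.comp x h1
  rw [h2.fderiv]
  exact euclideanToMatrix_mulVec _ w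

/-- For a regular level set `M` of `h` and a matrix-valued map whose value at `p` has kernel `ℝ k`,
transversality of its restriction to the matrices of corank one is surjectivity of the derivative
along `M` from the kernel to the cokernel. -/
theorem restrictTransversalAt_corankSet_iff {m : ℕ} {G : Type*} [NormedAddCommGroup G]
    [NormedSpace ℝ G] [FiniteDimensional ℝ G] {h : EuclideanSpace ℝ κ → G} (hh : ContDiff ℝ ∞ h)
    (p : ↥(h ⁻¹' {0})) (hs : Function.Surjective (fderiv ℝ h p))
    (hdim : Fintype.card κ = m + Module.finrank ℝ G)
    {g : EuclideanSpace ℝ κ → EuclideanSpace ℝ ι} (hg : ContDiff ℝ ∞ g)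
    {k : EuclideanSpace ℝ κ} (hk0 : k ≠ 0) (hk : ∀ v, fderiv ℝ g p v = 0 ↔ ∃ c : ℝ, v = c • k) :
    RestrictTransversalAt (jacobianMatrix g) (h ⁻¹' {0}) (corankSet ι κ 1) (p : _) ↔
      ∀ w, ∃ v u, fderiv ℝ h p v = 0 ∧
        fderiv ℝ (fderiv ℝ g) p v k + fderiv ℝ g p u = w := by
  have hk0' : k.ofLp ≠ 0 := fun h => hk0 (by ext i; exact congrFun h i)
  have hk' : ∀ v, jacobianMatrix g p *ᵥ v = 0 ↔ ∃ c : ℝ, v = c • k.ofLp := fun v => by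
    rw [jacobianMatrix_mulVec, WithLp.ofLp_eq_zero, hk]
    refine exists_congr fun c => ?_
    exact ⟨fun h => congrArg WithLp.ofLp h, fun h => congrArg (WithLp.toLp 2) h⟩
  have hmem : jacobianMatrix g p ∈ corankSet ι κ 1 :=
    (Matrix.rank_add_one_eq_card_iff _).2 ⟨_, hk0', hk'⟩
  have hN : ∀ B, B ∈ submanifoldTangentSpace (corankSet ι κ 1) (jacobianMatrix g p) ↔
      ∃ u, B *ᵥ k.ofLp = (fderiv ℝ g p u).ofLp := fun B => by
    rw [mem_submanifoldTangentSpace_corankSet_iff hk0' hk']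
    exact ⟨fun ⟨u, hu⟩ => ⟨_, hu.trans (jacobianMatrix_mulVec _ _ _)⟩,
      fun ⟨u, hu⟩ => ⟨u.ofLp, hu.trans (jacobianMatrix_mulVec _ _ _).symm⟩⟩
  have hM : submanifoldTangentSpace (h ⁻¹' {0}) (p : EuclideanSpace ℝ κ) =
      LinearMap.ker (fderiv ℝ h p).toLinearMap :=
    submanifoldTangentSpace_preimage_eq_ker (m := m) hh p hs (by rw [finrank_euclideanSpace, hdim])
  rw [RestrictTransversalAt, hM]
  refine ⟨fun H w => ?_, fun H _ => ?_⟩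
  -- Every `w` is the value at `k` of a matrix.
  · obtain ⟨q, hq⟩ : ∃ q : κ → ℝ, q ⬝ᵥ k.ofLp = 1 := by
      refine ⟨(k.ofLp ⬝ᵥ k.ofLp)⁻¹ • k.ofLp, ?_⟩
      rw [smul_dotProduct, smul_eq_mul, inv_mul_cancel₀]
      exact fun h => hk0' (dotProduct_self_eq_zero.1 h)
    have h1 : Matrix.vecMulVec w.ofLp q ∈ (⊤ : Submodule ℝ (Matrix ι κ ℝ)) := trivial
    rw [← H hmem, Submodule.mem_sup] at h1
    obtain ⟨_, ⟨v, hv, rfl⟩, B, hB, hvB⟩ := h1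
    obtain ⟨u, hu⟩ := (hN B).1 hB
    refine ⟨v, u, hv, ?_⟩
    have h2 := congrArg (fun C => C *ᵥ k.ofLp) hvB
    simp only [Matrix.add_mulVec, Matrix.vecMulVec_mulVec, hq, hu] at h2
    have h3 := fderiv_jacobianMatrix_mulVec hg p v k.ofLp
    ext i
    have h4 : (fderiv ℝ (jacobianMatrix g) p v *ᵥ k.ofLp) i + (fderiv ℝ g p u) i = w i := by
      have h5 := congrFun h2 i
      simp only [MulOpposite.op_one, one_smul] at h5
      exact h5
    rw [h3] at h4
    exact h4
  · rw [eq_top_iff]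
    intro C _
    obtain ⟨v, u, hv, hvu⟩ := H (WithLp.toLp 2 (C *ᵥ k.ofLp))
    rw [Submodule.mem_sup]
    refine ⟨fderiv ℝ (jacobianMatrix g) p v, ⟨v, hv, rfl⟩, C - fderiv ℝ (jacobianMatrix g) p v,
      (hN _).2 ⟨u, ?_⟩, add_sub_cancel _ _⟩
    rw [Matrix.sub_mulVec, fderiv_jacobianMatrix_mulVec hg, sub_eq_iff_eq_add']
    exact (congrArg WithLp.ofLp hvu).symm

end Jacobian

/-- The Euclidean space on a disjoint union as a product. -/
noncomputable def euclideanSumEquiv (ι ι' : Type*) [Fintype ι] [Fintype ι'] :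
    EuclideanSpace ℝ (ι ⊕ ι') ≃L[ℝ] EuclideanSpace ℝ ι × EuclideanSpace ℝ ι' :=
  LinearEquiv.toContinuousLinearEquiv
    { toFun := fun w => (WithLp.toLp 2 fun i => w (Sum.inl i), WithLp.toLp 2 fun i => w (Sum.inr i))
      map_add' := fun _ _ => rfl
      map_smul' := fun _ _ => rfl
      invFun := fun w => WithLp.toLp 2 (Sum.elim w.1 w.2)
      left_inv := fun w => by ext (i | i) <;> rfl
      right_inv := fun w => rfl }

theorem ContinuousLinearMap.fderiv_fderiv_comp_apply {E F F' : Type*} [NormedAddCommGroup E]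
    [NormedSpace ℝ E] [NormedAddCommGroup F] [NormedSpace ℝ F] [NormedAddCommGroup F']
    [NormedSpace ℝ F'] (T : F →L[ℝ] F') {g : E → F} {x : E} (hg : ContDiffAt ℝ ∞ g x) (v w : E) :
    fderiv ℝ (fderiv ℝ fun y => T (g y)) x v w = T (fderiv ℝ (fderiv ℝ g) x v w) := by
  have h := fderiv_fderiv_comp (a := T) T.contDiff.contDiffAt hg v w
  have h1 : fderiv ℝ T = fun _ => T := by ext1 q; exact T.fderiv
  rw [h1] at h
  simpa using h

/-! ### Cross-caps -/

/-- Splitting off the first coordinate of the source of the cross-cap. -/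
noncomputable def crossCapSourceEquiv (k : ℕ) :
    EuclideanSpace ℝ (Fin (k + 1)) ≃L[ℝ] ℝ × EuclideanSpace ℝ (Fin k) :=
  LinearEquiv.toContinuousLinearEquiv (LinearEquiv.ofInjectiveOfFinrankEq
    { toFun := fun x => (x 0, WithLp.toLp 2 fun i => x i.succ)
      map_add' := fun _ _ => rfl
      map_smul' := fun _ _ => rfl }
    (by
      rw [injective_iff_map_eq_zero]
      intro x hx
      ext i
      refine Fin.cases ?_ (fun i => ?_) i
      · exact congrArg Prod.fst hx
      · exact congrFun (congrArg WithLp.ofLp (congrArg Prod.snd hx)) i)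
    (by simp [add_comm]))

/-- Grouping the coordinates of the target of the cross-cap as in `whitneyUmbrella`. -/
noncomputable def crossCapTargetEquiv (k : ℕ) :
    EuclideanSpace ℝ (Fin (2 * (k + 1) - 1)) ≃L[ℝ]
      EuclideanSpace ℝ (Fin k) × (ℝ × EuclideanSpace ℝ (Fin k)) :=
  LinearEquiv.toContinuousLinearEquiv (LinearEquiv.ofInjectiveOfFinrankEq
    { toFun := fun w => (WithLp.toLp 2 fun i : Fin k => w ⟨i + 1, by omega⟩,
        (w ⟨0, by omega⟩, WithLp.toLp 2 fun i : Fin k => w ⟨k + 1 + i, by omega⟩))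
      map_add' := fun _ _ => rfl
      map_smul' := fun _ _ => rfl }
    (by
      rw [injective_iff_map_eq_zero]
      intro w hw
      have h1 := congrArg WithLp.ofLp (congrArg Prod.fst hw)
      have h2 := congrArg Prod.fst (congrArg Prod.snd hw)
      have h3 := congrArg WithLp.ofLp (congrArg Prod.snd (congrArg Prod.snd hw))
      ext ⟨i, hi⟩
      rcases Nat.eq_zero_or_pos i with rfl | hi0
      · exact h2
      by_cases hik : i < k + 1
      · have h4 : w ⟨i - 1 + 1, by omega⟩ = 0 := congrFun h1 ⟨i - 1, by omega⟩
        simp only [Nat.sub_add_cancel hi0] at h4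
        exact h4
      · have h4 : w ⟨k + 1 + (i - (k + 1)), by omega⟩ = 0 :=
          congrFun h3 ⟨i - (k + 1), by omega⟩
        simp only [Nat.add_sub_cancel' (not_lt.1 hik)] at h4
        exact h4)
    (by simp; omega))

theorem crossCapTargetEquiv_crossCapNormalForm (k : ℕ) (x : EuclideanSpace ℝ (Fin (k + 1))) :
    crossCapTargetEquiv k (crossCapNormalForm (k + 1) x) =
      whitneyUmbrella (crossCapSourceEquiv k x) := by
  refine Prod.ext ?_ (Prod.ext ?_ ?_)
  · ext i
    change crossCapNormalForm (k + 1) x ⟨i + 1, by omega⟩ = x i.succ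
    simp only [crossCapNormalForm]
    rw [if_neg (by simp), dif_pos (by simp)]
    rfl
  · change crossCapNormalForm (k + 1) x ⟨0, by omega⟩ = x 0 ^ 2
    simp only [crossCapNormalForm]
    rw [if_pos trivial]
    rfl
  · ext i
    change crossCapNormalForm (k + 1) x ⟨k + 1 + i, by omega⟩ = x 0 * x i.succ
    simp only [crossCapNormalForm]
    rw [if_neg (by simp), dif_neg (by simp only [not_lt]; omega)]
    exact congrArg (fun j => x 0 * x j) (Fin.ext (by simp))

theorem germEquiv_whitneyUmbrella_crossCapNormalForm (k : ℕ) :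
    GermEquiv (whitneyUmbrella : ℝ × EuclideanSpace ℝ (Fin k) → _) 0
      (crossCapNormalForm (k + 1)) 0 := by
  refine GermEquiv.of_hasFDerivAt (a := (crossCapSourceEquiv k).symm)
    (b := (crossCapTargetEquiv k).symm)
    contDiff_whitneyUmbrella.continuous.continuousAt
    ((crossCapSourceEquiv k).symm.contDiff.smoothNear _)
    (crossCapSourceEquiv k).symm.hasFDerivAt (map_zero _)
    ((crossCapTargetEquiv k).symm.contDiff.smoothNear _)
    (crossCapTargetEquiv k).symm.hasFDerivAt (Eventually.of_forall fun u => ?_)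
  rw [ContinuousLinearEquiv.symm_apply_eq, crossCapTargetEquiv_crossCapNormalForm,
    ContinuousLinearEquiv.apply_symm_apply]

theorem contDiff_crossCapNormalForm (k : ℕ) : ContDiff ℝ ∞ (crossCapNormalForm (k + 1)) := by
  have h : crossCapNormalForm (k + 1) = fun x =>
      (crossCapTargetEquiv k).symm (whitneyUmbrella (crossCapSourceEquiv k x)) := by
    ext1 x
    rw [← crossCapTargetEquiv_crossCapNormalForm, ContinuousLinearEquiv.symm_apply_apply]
  rw [h]
  exact (crossCapTargetEquiv k).symm.contDiff.comp
    (contDiff_whitneyUmbrella.comp (crossCapSourceEquiv k).contDiff)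

theorem isWhitneyPoint_crossCapNormalForm (k : ℕ) : IsWhitneyPoint (crossCapNormalForm (k + 1)) 0 :=
  isWhitneyPoint_whitneyUmbrella.of_germEquiv (germEquiv_whitneyUmbrella_crossCapNormalForm k)
    contDiff_whitneyUmbrella.contDiffAt (contDiff_crossCapNormalForm k).contDiffAt

section CrossCap

variable {E : Type*} [NormedAddCommGroup E] [NormedSpace ℝ E] {M : Set E} {k : ℕ}

/-- At a cross-cap, the map is given in some coordinates by a map with a Whitney point. -/
theorem IsCrossCap.exists_isWhitneyPoint
    {f : E → EuclideanSpace ℝ (Fin (2 * (k + 1) - 1))} {p : M} (hf : ContDiff ℝ ∞ f)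
    (h : IsCrossCap (m := k + 1) (fun x : M => f x) p) :
    ∃ φ : OpenPartialHomeomorph M (EuclideanSpace ℝ (Fin (k + 1))), IsSubmanifoldChart φ ∧
      p ∈ φ.source ∧ φ p = 0 ∧ IsWhitneyPoint (fun t => f (φ.symm t)) 0 := by
  obtain ⟨φ, ψ, hφ, hpφ, hφp, hψ, hfp, hψp, heq⟩ := h
  refine ⟨φ, hφ, hpφ, hφp, ?_⟩
  have h0 : (0 : EuclideanSpace ℝ (Fin (k + 1))) ∈ φ.target := hφp ▸ φ.map_source hpφ
  refine (isWhitneyPoint_crossCapNormalForm k).of_germEquiv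
    ⟨OpenPartialHomeomorph.refl _, ψ.symm, isSmoothCoordinates_refl, mem_univ _, rfl, hψ.symm, ?_⟩
    (contDiff_crossCapNormalForm k).contDiffAt
    (hf.contDiffAt.comp _ (hφ.1.contDiffAt (φ.open_target.mem_nhds h0)))
  filter_upwards [heq] with x hx
  rw [← hx.2]
  exact ⟨ψ.map_source hx.1, ψ.left_inv hx.1⟩

/-- If a map has a Whitney point in some coordinates, then it has a cross-cap. -/
theorem IsSubmanifoldChart.isCrossCap
    {f : E → EuclideanSpace ℝ (Fin (2 * (k + 1) - 1))} {p : M} (hf : ContDiff ℝ ∞ f)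
    {φ : OpenPartialHomeomorph M (EuclideanSpace ℝ (Fin (k + 1)))} (hφ : IsSubmanifoldChart φ)
    (hpφ : p ∈ φ.source) (hφp : φ p = 0) (h : IsWhitneyPoint (fun t => f (φ.symm t)) 0) :
    IsCrossCap (m := k + 1) (fun x : M => f x) p := by
  have h0 : (0 : EuclideanSpace ℝ (Fin (k + 1))) ∈ φ.target := hφp ▸ φ.map_source hpφ
  have hp0 : φ.symm 0 = p := by rw [← hφp, φ.left_inv hpφ]
  have hθ : SmoothNear (fun t => (φ.symm t : E)) 0 := hφ.1.smoothNear φ.open_target h0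
  have hg : SmoothNear (fun t => f (φ.symm t)) 0 :=
    SmoothNear.comp (hf.smoothNear _) hθ
  obtain ⟨α, ψ, hα, h0α, hα0, hψ, heq⟩ := (h.germEquiv (Y := EuclideanSpace ℝ (Fin k))
    (by simp) (by simp; omega) hg).trans (germEquiv_whitneyUmbrella_crossCapNormalForm k)
  have h0α' : (0 : EuclideanSpace ℝ (Fin (k + 1))) ∈ α.target := hα0 ▸ α.map_source h0α
  have hα0' : α.symm 0 = 0 := by
    have := α.left_inv h0α
    rwa [hα0] at this
  refine ⟨φ.trans α, ψ, ⟨?_, fun x hx => ?_⟩, ?_, ?_, hψ, ?_, ?_, ?_⟩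
  · refine hφ.1.comp (hα.2.mono ?_) ?_
    · rw [φ.trans_target]; exact inter_subset_left
    · rw [φ.trans_target]; exact fun x hx => hx.2
  · rw [φ.trans_target] at hx
    obtain ⟨B, hB⟩ := hα.symm.exists_hasFDerivAt (x := x) hx.1
    have h1 := ((hφ.1.contDiffAt (φ.open_target.mem_nhds hx.2)).differentiableAt
      (by simp)).hasFDerivAt.comp x hB
    have h2 : fderiv ℝ (fun x => ((φ.trans α).symm x : E)) x = _ := h1.fderiv
    rw [h2]
    exact (hφ.2 _ hx.2).comp B.injective
  · rw [φ.trans_source]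
    exact ⟨hpφ, by rw [mem_preimage, hφp]; exact h0α⟩
  · change α (φ p) = 0
    rw [hφp, hα0]
  · have := heq.self_of_nhds.1
    simpa only [hp0] using this
  · have := heq.self_of_nhds.2
    simp only [hp0, hα0] at this
    rw [this, ← map_zero (crossCapSourceEquiv k).symm,
      ← (crossCapTargetEquiv k).map_eq_zero_iff, crossCapTargetEquiv_crossCapNormalForm,
      ContinuousLinearEquiv.apply_symm_apply]
    ext <;> simp [whitneyUmbrella]
  · have h1 : Tendsto α.symm (𝓝 0) (𝓝 0) := by
      have := α.symm.continuousAt (x := 0) h0α'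
      rwa [ContinuousAt, hα0'] at this
    filter_upwards [h1.eventually heq, α.open_target.mem_nhds h0α'] with x hx hx'
    rw [α.right_inv hx'] at hx
    exact hx

end CrossCap

theorem proposition6p2 (m l : ℕ) (hm : 1 ≤ m)
    (h : EuclideanSpace ℝ (Fin (m + l)) → EuclideanSpace ℝ (Fin l))
    (hh : ContDiff ℝ ∞ h)
    (hrank : ∀ x ∈ h ⁻¹' {0}, (jacobianMatrix h x).rank = l)
    (f : EuclideanSpace ℝ (Fin (m + l)) → EuclideanSpace ℝ (Fin (2 * m - 1)))
    (hf : ContDiff ℝ ∞ f)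
    (p : ↥(h ⁻¹' {0})) :
    IsCrossCap ((h ⁻¹' {0}).domRestrict f) p ↔
      (jacobianMatrix (mapPair h f) p).rank = m + l - 1 ∧
      RestrictTransversalAt (jacobianMatrix (mapPair h f)) (h ⁻¹' {0})
        (corankSet (Fin l ⊕ Fin (2 * m - 1)) (Fin (m + l)) 1) p := by
  obtain ⟨k, rfl⟩ : ∃ k, m = k + 1 := ⟨m - 1, by omega⟩
  have hs : Function.Surjective (fderiv ℝ h p) := by
    have h1 : LinearMap.range (jacobianMatrix h p).mulVecLin = ⊤ := by
      refine Submodule.eq_top_of_finrank_eq ?_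
      rw [Module.finrank_fintype_fun_eq_card, Fintype.card_fin]
      exact hrank p p.2
    intro w
    obtain ⟨v, hv⟩ := LinearMap.range_eq_top.1 h1 w.ofLp
    refine ⟨WithLp.toLp 2 v, ?_⟩
    ext i
    exact congrFun ((jacobianMatrix_mulVec h p v).symm.trans hv) i
  have hdim : Module.finrank ℝ (EuclideanSpace ℝ (Fin (k + 1 + l))) =
      (k + 1) + Module.finrank ℝ (EuclideanSpace ℝ (Fin l)) := by simp
  set T := euclideanSumEquiv (Fin l) (Fin (2 * (k + 1) - 1))
  set H := mapPair h f
  have hHs : ContDiff ℝ ∞ H := by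
    have h1 : H = fun x => T.symm (h x, f x) := rfl
    rw [h1]
    exact T.symm.contDiff.comp (hh.prodMk hf)
  have hd1 : ∀ v, T (fderiv ℝ H p v) = (fderiv ℝ h p v, fderiv ℝ f p v) := fun v => by
    have h1 := T.hasFDerivAt.comp (p : EuclideanSpace ℝ (Fin (k + 1 + l)))
      (hHs.differentiable (by simp) p).hasFDerivAt
    have h2 := (hh.differentiable (by simp) p).hasFDerivAt.prodMk
      (hf.differentiable (by simp) p).hasFDerivAt
    exact DFunLike.congr_fun (h1.unique h2) v
  have hd2 : ∀ v w, T (fderiv ℝ (fderiv ℝ H) p v w) =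
      (fderiv ℝ (fderiv ℝ h) p v w, fderiv ℝ (fderiv ℝ f) p v w) := fun v w => by
    have h1 := ((ContinuousLinearMap.fst ℝ _ _).comp
      T.toContinuousLinearMap).fderiv_fderiv_comp_apply (x := (p : EuclideanSpace ℝ (Fin (k + 1 + l)))) hHs.contDiffAt v w
    have h2 := ((ContinuousLinearMap.snd ℝ _ _).comp
      T.toContinuousLinearMap).fderiv_fderiv_comp_apply (x := (p : EuclideanSpace ℝ (Fin (k + 1 + l)))) hHs.contDiffAt v w
    exact Prod.ext h1.symm h2.symm
  have hker : ∀ v, fderiv ℝ H p v = 0 ↔ fderiv ℝ h p v = 0 ∧ fderiv ℝ f p v = 0 := fun v => by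
    rw [← T.map_eq_zero_iff, hd1, Prod.mk_eq_zero]
  -- The right-hand side as a condition on the 2-jet of `(h, f)` at `p`.
  have hR : ((jacobianMatrix H p).rank = k + 1 + l - 1 ∧
      RestrictTransversalAt (jacobianMatrix H) (h ⁻¹' {0})
        (corankSet (Fin l ⊕ Fin (2 * (k + 1) - 1)) (Fin (k + 1 + l)) 1) p) ↔
      ∃ κ : EuclideanSpace ℝ (Fin (k + 1 + l)), κ ≠ 0 ∧
        (∀ v, (fderiv ℝ h p v = 0 ∧ fderiv ℝ f p v = 0) ↔ ∃ c : ℝ, v = c • κ) ∧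
        ∀ w₁ w₂, ∃ v u, fderiv ℝ h p v = 0 ∧
          fderiv ℝ (fderiv ℝ h) p v κ + fderiv ℝ h p u = w₁ ∧
          fderiv ℝ (fderiv ℝ f) p v κ + fderiv ℝ f p u = w₂ := by
    have htr : ∀ κ : EuclideanSpace ℝ (Fin (k + 1 + l)), κ ≠ 0 →
        (∀ v, fderiv ℝ H p v = 0 ↔ ∃ c : ℝ, v = c • κ) →
        (RestrictTransversalAt (jacobianMatrix H) (h ⁻¹' {0})
          (corankSet (Fin l ⊕ Fin (2 * (k + 1) - 1)) (Fin (k + 1 + l)) 1) p ↔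
        ∀ w₁ w₂, ∃ v u, fderiv ℝ h p v = 0 ∧
          fderiv ℝ (fderiv ℝ h) p v κ + fderiv ℝ h p u = w₁ ∧
          fderiv ℝ (fderiv ℝ f) p v κ + fderiv ℝ f p u = w₂) := fun κ hκ0 hκ => by
      rw [restrictTransversalAt_corankSet_iff (m := k + 1) hh p hs (by simp) hHs hκ0 hκ]
      have h1 : ∀ v u w, fderiv ℝ (fderiv ℝ H) p v κ + fderiv ℝ H p u = w ↔
          fderiv ℝ (fderiv ℝ h) p v κ + fderiv ℝ h p u = (T w).1 ∧
          fderiv ℝ (fderiv ℝ f) p v κ + fderiv ℝ f p u = (T w).2 := fun v u w => by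
        rw [← T.injective.eq_iff, map_add, hd1, hd2, Prod.mk_add_mk, Prod.ext_iff]
      simp only [h1]
      constructor
      · intro h2 w₁ w₂
        simpa using h2 (T.symm (w₁, w₂))
      · exact fun h2 w => h2 _ _
    have hrk : (jacobianMatrix H p).rank = k + 1 + l - 1 ↔
        (jacobianMatrix H p).rank + 1 = Fintype.card (Fin (k + 1 + l)) := by
      rw [Fintype.card_fin]
      omega
    rw [hrk, Matrix.rank_add_one_eq_card_iff]
    constructor
    · rintro ⟨⟨κ, hκ0, hκ⟩, htrans⟩
      have hκ' : ∀ v, fderiv ℝ H p v = 0 ↔ ∃ c : ℝ, v = c • WithLp.toLp 2 κ := fun v => by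
        have h1 := hκ v.ofLp
        rw [jacobianMatrix_mulVec, WithLp.ofLp_eq_zero] at h1
        exact h1.trans (exists_congr fun c =>
          ⟨fun h => congrArg (WithLp.toLp 2) h, fun h => congrArg WithLp.ofLp h⟩)
      have hκ0' : (WithLp.toLp 2 κ : EuclideanSpace ℝ (Fin (k + 1 + l))) ≠ 0 :=
        fun h => hκ0 (congrArg WithLp.ofLp h)
      exact ⟨WithLp.toLp 2 κ, hκ0', fun v => (hker v).symm.trans (hκ' v),
        (htr _ hκ0' hκ').1 htrans⟩
    · rintro ⟨κ, hκ0, hκ, hsurj⟩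
      refine ⟨⟨κ.ofLp, fun h => hκ0 (congrArg (WithLp.toLp 2) h), fun v => ?_⟩,
        (htr κ hκ0 fun v => (hker v).trans (hκ v)).2 hsurj⟩
      rw [jacobianMatrix_mulVec, WithLp.ofLp_eq_zero, hker, hκ]
      exact exists_congr fun c =>
        ⟨fun h => congrArg WithLp.ofLp h, fun h => congrArg (WithLp.toLp 2) h⟩
  -- In any coordinate system centred at `p`, this is the condition for a Whitney point.
  have hchart : ∀ φ : OpenPartialHomeomorph ↥(h ⁻¹' {0}) (EuclideanSpace ℝ (Fin (k + 1))),
      IsSubmanifoldChart φ → p ∈ φ.source → φ p = 0 →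
      (IsWhitneyPoint (fun t => f (φ.symm t)) 0 ↔ (jacobianMatrix H p).rank = k + 1 + l - 1 ∧
        RestrictTransversalAt (jacobianMatrix H) (h ⁻¹' {0})
          (corankSet (Fin l ⊕ Fin (2 * (k + 1) - 1)) (Fin (k + 1 + l)) 1) p) := fun φ hφ hpφ hφp => by
    have h0 : (0 : EuclideanSpace ℝ (Fin (k + 1))) ∈ φ.target := hφp ▸ φ.map_source hpφ
    have hp0 : φ.symm 0 = p := by rw [← hφp, φ.left_inv hpφ]
    have hθ := hφ.1.contDiffAt (φ.open_target.mem_nhds h0)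
    have hs' : Function.Surjective (fderiv ℝ h (φ.symm 0)) := by rwa [hp0]
    have h1 := isWhitneyPoint_comp_iff (θ := fun t => (φ.symm t : EuclideanSpace ℝ (Fin (k + 1 + l))))
      (hh.contDiffAt) (hf.contDiffAt) hθ (Eventually.of_forall fun s => (φ.symm s).2) (hφ.2 0 h0) hs'
      (fderiv_eq_zero_iff_exists (hh.differentiable (by simp) _) (hθ.differentiableAt (by simp))
        (Eventually.of_forall fun s => (φ.symm s).2) (hφ.2 0 h0) hs' (by simp only [hdim, finrank_euclideanSpace_fin]))
    rw [hp0] at h1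
    exact h1.trans hR.symm
  constructor
  · intro hc
    obtain ⟨φ, hφ, hpφ, hφp, hw⟩ := IsCrossCap.exists_isWhitneyPoint hf hc
    exact (hchart φ hφ hpφ hφp).1 hw
  · intro hw
    obtain ⟨φ, hφ, hpφ, hφp⟩ := exists_isSubmanifoldChart hh p hs hdim
    exact hφ.isCrossCap hf hpφ hφp ((hchart φ hφ hpφ hφp).2 hw)
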